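/- Let $\mathcal N$ be a von Neumann algebra on a complex Hilbert space $\mathcal H$ with a faithful normal semifinite trace $\tau$, and let $P,Q\in\mathcal N$ be projections. For $T\in P\mathcal N Q$ let $R_T$ be the projection onto $\overline{\mathrm{range}(T)}$, $\mathrm{supp}(T)$ the projection onto $\ker(T)^\perp$, and $N^Q_T$ the projection onto $\ker(T)\cap Q(\mathcal H)$. The operator $T\in P\mathcal N Q$ is called $(P\cdot Q)$-Fredholm if $\tau(N^Q_T)<\infty$, $\tau(N^P_{T^*})<\infty$, and there is a projection $E\in\mathcal N$ with $E\le P$, $\tau(E)<\infty$ and $\mathrm{range}(P-E)\subseteq\mathrm{range}(T)$. Its $(P\cdot Q)$-index is then $\mathrm{Ind}(T)=\tau(N^Q_T)-\tau(N^P_{T^*})$. Let $T\in P\mathcal N Q$. Then: (1) Put $P_1=R_T$ and $Q_1=Q-N^Q_T$. Then $Q_1=\mathrm{supp}(T)=R_{T^*}$, and $P_1\le P$ and $Q_1\le Q$ are projections in $\mathcal N$. The operator $T$ is $(P\cdot Q)$-Fredholm if and only if $T$ is $(P_1\cdot Q_1)$-Fredholm, $\tau(Q-Q_1)<\infty$ and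 $\tau(P-P_1)<\infty$. If $T$ is $(P_1\cdot Q_1)$-Fredholm, its $(P_1\cdot Q_1)$-index is $0$. If $T$ is $(P\cdot Q)$-Fredholm, its $(P\cdot Q)$-index is $\tau(Q-Q_1)-\tau(P-P_1)$. (2) If $T$ is $(P\cdot Q)$-Fredholm, then $T^*$ is $(Q\cdot P)$-Fredholm and $\mathrm{Ind}(T^*)=-\mathrm{Ind}(T)$. If moreover $T=V|T|$ is the polar decomposition, then $V$ is $(P\cdot Q)$-Fredholm with $\mathrm{Ind}(V)=\mathrm{Ind}(T)$, and $|T|$ is $(Q\cdot Q)$-Fredholm of index $0$. (3) If $T$ is $(P\cdot Q)$-Fredholm with polar decomposition $T=V|T|$, then there is a spectral projection $Q_0\in\mathcal N$ of $|T|$ with $Q_0\le Q$ and $\tau(Q-Q_0)<\infty$ such that $P_0=VQ_0V^*$ is a projection in $\mathcal N$ with $P_0\le P$, $\tau(P-P_0)<\infty$, $P_0(\mathcal H)=\mathrm{range}(TQ_0)\subseteq\mathrm{range}(T)$ and $Q_0(\mathcal H)\subseteq\mathrm{range}(T^*)$. Moreover $TQ_0=P_0TQ_0$ and $T^*P_0=Q_0T^*P_0$,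 and the restrictions $TQ_0:Q_0(\mathcal H)\to P_0(\mathcal H)$ and $T^*P_0:P_0(\mathcal H)\to Q_0(\mathcal H)$ are invertible as bounded linear operators. (4) The set of all $(P\cdot Q)$-Fredholm operators in $P\mathcal N Q$ is open in $P\mathcal N Q$ in the norm topology. -/

import Mathlib

open scoped ENNReal

namespace SkewFredholm

noncomputable section

section Definitions

variable {H : Type*} [NormedAddCommGroup H] [InnerProductSpace ℂ H] [CompleteSpace H]

/-- `P` is a projection (self-adjoint idempotent) of the von Neumann algebra `N`. -/
def IsProjIn (N : VonNeumannAlgebra H) (P : H →L[ℂ] H) : Prop :=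
  P ∈ N ∧ IsStarProjection P

/-- `τ` is a faithful normal semifinite trace on the von Neumann algebra `N`: a map from the
positive cone of `N` to `[0, ∞]`. The function `τ` is defined on all operators for convenience;
only its values on the positive cone of `N` matter. `≤` is the Loewner order. -/
structure IsFNSTrace (N : VonNeumannAlgebra H) (τ : (H →L[ℂ] H) → ℝ≥0∞) : Prop where
  /-- additivity -/
  map_add : ∀ x ∈ N, 0 ≤ x → ∀ y ∈ N, 0 ≤ y → τ (x + y) = τ x + τ y
  /-- homogeneity, with the convention `0 * ∞ = 0` -/
  map_smul : ∀ c : NNReal, ∀ x ∈ N, 0 ≤ x → τ (((c : ℝ) : ℂ) • x) = (c : ℝ≥0∞) * τ x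
  /-- the trace property -/
  trace : ∀ x ∈ N, τ (star x * x) = τ (x * star x)
  /-- faithfulness -/
  faithful : ∀ x ∈ N, 0 ≤ x → τ x = 0 → x = 0
  /-- normality: `τ` preserves suprema of bounded upward directed families -/
  normal : ∀ S : Set (H →L[ℂ] H), S.Nonempty → (∀ x ∈ S, x ∈ N ∧ 0 ≤ x) →
    DirectedOn (fun x y => x ≤ y) S → ∀ y, IsLUB S y → τ y = ⨆ x ∈ S, τ x
  /-- semifiniteness: every nonzero positive element dominates a nonzero one of finite trace -/
  semifinite : ∀ x ∈ N, 0 ≤ x → x ≠ 0 → ∃ y ∈ N, 0 ≤ y ∧ y ≤ x ∧ y ≠ 0 ∧ τ y < ∞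

/-- The skew-corner `P N Q`. -/
def corner (N : VonNeumannAlgebra H) (P Q : H →L[ℂ] H) : Set (H →L[ℂ] H) :=
  {T | ∃ A ∈ N, T = P * A * Q}

/-- The orthogonal projection onto the closure of a subspace. -/
def projOn (K : Submodule ℂ H) : H →L[ℂ] H := K.topologicalClosure.starProjection

/-- `R_T`, the projection onto the closure of the range of `T`. -/
def rangeProj (T : H →L[ℂ] H) : H →L[ℂ] H := projOn T.range

/-- `supp T`, the projection onto the orthogonal complement of the kernel of `T`. -/
def suppProj (T : H →L[ℂ] H) : H →L[ℂ] H := projOn T.kerᗮ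

/-- `N_T^Q`, the projection onto `ker T ∩ Q(H)` (a closed subspace if `Q` is a projection). -/
def kerProjIn (Q T : H →L[ℂ] H) : H →L[ℂ] H := projOn (T.ker ⊓ Q.range)

/-- `T` is a `(P·Q)`-Fredholm operator of `P N Q`. -/
structure IsFredholm (N : VonNeumannAlgebra H) (τ : (H →L[ℂ] H) → ℝ≥0∞)
    (P Q T : H →L[ℂ] H) : Prop where
  mem_corner : T ∈ corner N P Q
  ker_finite : τ (kerProjIn Q T) < ∞
  coker_finite : τ (kerProjIn P (star T)) < ∞
  exists_cofinite : ∃ E, IsProjIn N E ∧ E ≤ P ∧ τ E < ∞ ∧ (P - E).range ≤ T.range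

/-- The `(P·Q)`-index `τ(N_T^Q) - τ(N_{T*}^P)` (meaningful for `(P·Q)`-Fredholm `T`, when both
terms are finite). -/
def index (τ : (H →L[ℂ] H) → ℝ≥0∞) (P Q T : H →L[ℂ] H) : ℝ :=
  (τ (kerProjIn Q T)).toReal - (τ (kerProjIn P (star T))).toReal

/-- `|T| = (T* T)^{1/2}`. -/
abbrev absOp (T : H →L[ℂ] H) : H →L[ℂ] H := CFC.abs T

/-- `T = V|T|` is the polar decomposition of `T`: `V` is a partial isometry with the same kernel
as `T`. -/
structure IsPolarDecomposition (T V : H →L[ℂ] H) : Prop where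
  partial_isometry : V * star V * V = V
  eq_mul_abs : T = V * absOp T
  ker_eq : V.ker = T.ker

/-- `μ` is the spectral measure of the self-adjoint operator `A` at the vector `x`:
`∫ f dμ = ⟨x, f(A) x⟩` for every continuous compactly supported `f`. -/
def IsSpectralMeasureAt (A : H →L[ℂ] H) (x : H) (μ : MeasureTheory.Measure ℝ) : Prop :=
  MeasureTheory.IsFiniteMeasure μ ∧
    ∀ f : ℝ → ℝ, Continuous f → HasCompactSupport f →
      ((∫ t, f t ∂μ : ℝ) : ℂ) = inner ℂ x ((cfc f A) x)

/-- `E` is a spectral projection of the self-adjoint operator `A`: `E = χ_B(A)` for some Borel set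
`B`, that is, `⟨x, E x⟩ = μ_x(B)` for every vector `x`, where `μ_x` is the spectral measure of `A`
at `x`. -/
def IsSpectralProjection (A E : H →L[ℂ] H) : Prop :=
  ∃ B : Set ℝ, MeasurableSet B ∧ ∀ x : H, ∃ μ : MeasureTheory.Measure ℝ,
    IsSpectralMeasureAt A x μ ∧ inner ℂ x (E x) = ((μ.real B : ℝ) : ℂ)

/-- `T` restricts to an invertible bounded operator from `Q₀(H)` onto `P₀(H)`. -/
def RestrictsToInvertible (T Q₀ P₀ : H →L[ℂ] H) : Prop :=
  ∃ S : Q₀.range ≃L[ℂ] P₀.range, ∀ x : Q₀.range, ((S x : P₀.range) : H) = T (x : H)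

end Definitions

end

theorem norm_absOp_apply {H : Type*} [NormedAddCommGroup H] [InnerProductSpace ℂ H]
    [CompleteSpace H] (T : H →L[ℂ] H) (x : H) : ‖absOp T x‖ = ‖T x‖ := by
  have hs : star (absOp T) = absOp T := (CFC.abs_nonneg T).isSelfAdjoint.star_eq
  have h : star (absOp T) * absOp T = star T * T := by rw [hs, CFC.abs_mul_abs]
  have key : ∀ A : H →L[ℂ] H, inner ℂ ((star A * A) x) x = ((‖A x‖ ^ 2 : ℝ) : ℂ) := by
    intro A
    rw [_root_.mul_apply_eq_comp, ContinuousLinearMap.star_eq_adjoint,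
      ContinuousLinearMap.adjoint_inner_left, inner_self_eq_norm_sq_to_K]
    push_cast; rfl
  have h2 := key (absOp T)
  rw [h, key T] at h2
  have h3 : ‖T x‖ ^ 2 = ‖absOp T x‖ ^ 2 := by exact_mod_cast h2
  exact ((pow_left_inj₀ (norm_nonneg _) (norm_nonneg _) two_ne_zero).1 h3).symm

/-- Every bounded operator has a polar decomposition. -/
theorem exists_isPolarDecomposition {H : Type*} [NormedAddCommGroup H] [InnerProductSpace ℂ H]
    [CompleteSpace H] (T : H →L[ℂ] H) : ∃ V, IsPolarDecomposition T V := by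
  set K : Submodule ℂ H := (absOp T).range.topologicalClosure with hK
  have hmem : ∀ x, absOp T x ∈ K := fun x => Submodule.le_topologicalClosure _ ⟨x, rfl⟩
  let e : H →ₗ[ℂ] K := (absOp T : H →ₗ[ℂ] H).codRestrict K hmem
  have hd : DenseRange e := by
    intro y
    rw [closure_subtype]
    have hy : (y : H) ∈ closure ((absOp T).range : Set H) := y.2
    convert hy using 2
    ext z
    constructor
    · rintro ⟨_, ⟨x, rfl⟩, rfl⟩; exact ⟨x, rfl⟩
    · rintro ⟨x, rfl⟩; exact ⟨e x, ⟨x, rfl⟩, rfl⟩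
  have hn : ∀ x, ‖(T : H →ₗ[ℂ] H) x‖ ≤ 1 * ‖e x‖ := by
    intro x; rw [one_mul]; exact (norm_absOp_apply T x).ge
  let W : K →L[ℂ] H := (T : H →ₗ[ℂ] H).extendOfNorm e
  have hW : ∀ x, W (e x) = T x := fun x => LinearMap.extendOfNorm_eq hd ⟨1, hn⟩ x
  have hWn : ∀ y, ‖W y‖ = ‖y‖ := by
    intro y
    refine hd.induction_on (p := fun y => ‖W y‖ = ‖y‖) y ?_ ?_
    · exact isClosed_eq (by fun_prop) (by fun_prop)
    · intro x; rw [hW]; exact (norm_absOp_apply T x).symm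
  let p := K.orthogonalProjectionOnto
  let V : H →L[ℂ] H := W ∘L p
  have hT : T = V * absOp T := by
    ext x
    have : p (absOp T x) = e x := K.orthogonalProjectionOnto_mem_subspace_eq_self (e x)
    change T x = W (p (absOp T x))
    rw [this, hW]
  have hsa : star (absOp T) = absOp T := (CFC.abs_nonneg T).isSelfAdjoint.star_eq
  have hker : V.ker = T.ker := by
    ext x
    have h1 : x ∈ V.ker ↔ x ∈ Kᗮ := by
      rw [← Submodule.orthogonalProjectionOnto_eq_zero_iff, LinearMap.mem_ker]
      change W (p x) = 0 ↔ p x = 0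
      rw [← norm_eq_zero, hWn, norm_eq_zero]
    rw [h1, hK, Submodule.orthogonal_closure, ContinuousLinearMap.orthogonal_range,
      ← ContinuousLinearMap.star_eq_adjoint, hsa, LinearMap.mem_ker, LinearMap.mem_ker]
    change absOp T x = 0 ↔ T x = 0
    rw [← norm_eq_zero, norm_absOp_apply, norm_eq_zero]
  refine ⟨V, ?_, hT, hker⟩
  have hWW : (ContinuousLinearMap.adjoint W) ∘L W = 1 :=
    (ContinuousLinearMap.norm_map_iff_adjoint_comp_self W).1 hWn
  ext x
  have hadj : star V = K.subtypeL ∘L ContinuousLinearMap.adjoint W := by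
    rw [ContinuousLinearMap.star_eq_adjoint, ContinuousLinearMap.adjoint_comp,
      Submodule.adjoint_orthogonalProjectionOnto]
  rw [hadj]
  have h2 : ContinuousLinearMap.adjoint W (W (p x)) = p x := congrArg (fun f => f (p x)) hWW
  change W (p ((ContinuousLinearMap.adjoint W (W (p x)) : K) : H)) = W (p x)
  rw [h2, K.orthogonalProjectionOnto_mem_subspace_eq_self]
end SkewFredholm

/-!
Fredholm operators relative to a trace on a von Neumann algebra, in skew corners `P N Q`.

Everything reduces to the support projection `supp T` and the range projection `R_T`. For
`T ∈ P N Q` one has `N_T^Q = Q - supp T` and `N_{T*}^P = P - R_T` (`kerProjIn_eq`,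
`kerProjIn_star_eq`), so the index is `τ(Q - supp T) - τ(P - R_T)`, and compressing to the corner
`R_T N supp T` makes it vanish. The partial isometry of the polar decomposition lies in `N`, hence
`τ(supp X) = τ(R_X)` for `X ∈ N`. Consequently an operator of `N` which maps `E(H)` injectively
into `F(H)` forces `τ(E) ≤ τ(F)` (`IsFNSTrace.le_of_injOn`); a projection meeting a projection of
finite cotrace trivially has finite trace (`IsFNSTrace.le_sub_of_disjoint`). All finiteness claims
come from these two facts.

If `F(H) ⊆ range T` for a projection `F`, the open mapping theorem bounds `T*` below on `F(H)`
(`exists_le_norm_star_apply`). So `T* F` has closed range; when `P - F` has finite trace and `T`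
is Fredholm, the complement in `Q` of that range has finite trace, because off `ker T` it is mapped
injectively into `(P - F)(H)`. This gives the Fredholm property of `T*` and of `|T|`, whose range
contains that of `T*`.

Moreover `|T|` is then bounded below by some `c > 0` on a projection of finite cotrace in `Q`,
while `|T| ≤ c / 2` on the kernel of `Q₀ = χ_{(c/2, ∞)}(|T|)`; the two meet trivially, so `Q - Q₀`
has finite trace. Here `χ_{(δ, ∞)}(A)` is realised as the range projection of `(A - δ)₊`, and
`max(A, δ)⁻¹` inverts `A` on it. That it is a spectral projection in the measure sense follows by
approximating the indicator function by continuous functions and dominated convergence.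

Finally `T` is bounded below on `Q₀(H)` and `Q₀ T*` on `P₀(H)`, where `P₀ = V Q₀ V*`. Such bounds
survive small perturbations of `T` and imply the Fredholm property
(`isFredholm_of_boundedBelow`), so the set of Fredholm operators is open.
-/

open scoped ENNReal

namespace SkewFredholm

variable {H : Type*} [NormedAddCommGroup H] [InnerProductSpace ℂ H] [CompleteSpace H]

/-! ### Projections onto supports and ranges -/

theorem _root_.IsStarProjection.mem_range_iff {E : H →L[ℂ] H} (hE : IsStarProjection E) {x : H} :
    x ∈ E.range ↔ E x = x := by
  constructor
  · rintro ⟨y, rfl⟩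
    exact DFunLike.congr_fun hE.isIdempotentElem.eq y
  · intro h
    exact ⟨x, h⟩

theorem _root_.IsStarProjection.apply_apply {E : H →L[ℂ] H} (hE : IsStarProjection E) (x : H) :
    E (E x) = E x :=
  DFunLike.congr_fun hE.isIdempotentElem.eq x

theorem _root_.IsStarProjection.star_eq {E : H →L[ℂ] H} (hE : IsStarProjection E) : star E = E :=
  hE.isSelfAdjoint.star_eq

theorem inner_star_left (A : H →L[ℂ] H) (x y : H) :
    inner ℂ ((star A) x) y = inner ℂ x (A y) := by
  rw [ContinuousLinearMap.star_eq_adjoint, ContinuousLinearMap.adjoint_inner_left]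

theorem _root_.IsStarProjection.norm_apply_le {E : H →L[ℂ] H} (hE : IsStarProjection E) (x : H) :
    ‖E x‖ ≤ ‖x‖ := by
  simpa using E.le_of_opNorm_le (IsStarProjection.norm_le E hE) x

theorem _root_.IsStarProjection.le_iff_forall {E F : H →L[ℂ] H} (hE : IsStarProjection E)
    (hF : IsStarProjection F) : E ≤ F ↔ ∀ x, E x = x → F x = x := by
  rw [hE.le_iff_mul_eq_right hF]
  constructor
  · intro h x hx
    have := DFunLike.congr_fun h x
    rwa [mul_apply_eq_comp, hx] at this
  · intro h
    ext x
    exact h _ (hE.apply_apply x)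

theorem _root_.IsStarProjection.ext_forall {E F : H →L[ℂ] H} (hE : IsStarProjection E)
    (hF : IsStarProjection F) (h : ∀ x, E x = x ↔ F x = x) : E = F :=
  le_antisymm ((hE.le_iff_forall hF).2 fun x => (h x).1) ((hF.le_iff_forall hE).2 fun x => (h x).2)

theorem _root_.IsStarProjection.ext_ker {E F : H →L[ℂ] H} (hE : IsStarProjection E)
    (hF : IsStarProjection F) (h : ∀ x, E x = 0 ↔ F x = 0) : E = F := by
  have := hE.one_sub.ext_forall hF.one_sub fun x => by simpa using h x
  simpa using this

theorem _root_.IsStarProjection.sub_apply_eq_self_iff {E F : H →L[ℂ] H} (hE : IsStarProjection E)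
    (hF : IsStarProjection F) (h : E ≤ F) {x : H} : (F - E) x = x ↔ F x = x ∧ E x = 0 := by
  have h1 : ∀ y, E (F y) = E y := DFunLike.congr_fun ((hE.le_iff_mul_eq_left hF).1 h)
  have h2 : ∀ y, F (E y) = E y := DFunLike.congr_fun ((hE.le_iff_mul_eq_right hF).1 h)
  simp only [sub_apply]
  constructor
  · intro hx
    have h3 : E x = 0 := by
      rw [← hx, map_sub, h1, hE.apply_apply, sub_self]
    exact ⟨by rw [h3, sub_zero] at hx; exact hx, h3⟩
  · rintro ⟨h3, h4⟩
    rw [h3, h4, sub_zero]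

theorem isStarProjection_projOn (K : Submodule ℂ H) : IsStarProjection (projOn K) :=
  isStarProjection_starProjection

theorem projOn_apply_eq_self_iff {K : Submodule ℂ H} {x : H} :
    projOn K x = x ↔ x ∈ K.topologicalClosure :=
  Submodule.starProjection_eq_self_iff

theorem projOn_apply_eq_self_iff_of_isClosed {K : Submodule ℂ H} (hK : IsClosed (K : Set H))
    {x : H} : projOn K x = x ↔ x ∈ K := by
  rw [projOn_apply_eq_self_iff, hK.submodule_topologicalClosure_eq]

theorem projOn_apply_eq_self {K : Submodule ℂ H} {x : H} (h : x ∈ K) : projOn K x = x :=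
  projOn_apply_eq_self_iff.2 (K.le_topologicalClosure h)

theorem projOn_apply_eq_zero_iff {K : Submodule ℂ H} {x : H} : projOn K x = 0 ↔ x ∈ Kᗮ := by
  rw [← Submodule.orthogonal_closure, ← Submodule.ker_starProjection]
  rfl

/-- The projection onto the closure of `K` is the least projection fixing `K` pointwise. -/
theorem projOn_le {K : Submodule ℂ H} {F : H →L[ℂ] H} (hF : IsStarProjection F)
    (h : ∀ x ∈ K, F x = x) : projOn K ≤ F := by
  rw [(isStarProjection_projOn K).le_iff_forall hF]
  intro x hx
  rw [projOn_apply_eq_self_iff] at hx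
  refine closure_minimal (s := (K : Set H)) (t := {x | F x = x}) h ?_ hx
  exact isClosed_eq F.continuous continuous_id

theorem isStarProjection_suppProj (T : H →L[ℂ] H) : IsStarProjection (suppProj T) :=
  isStarProjection_projOn _

theorem isStarProjection_rangeProj (T : H →L[ℂ] H) : IsStarProjection (rangeProj T) :=
  isStarProjection_projOn _

theorem suppProj_apply_eq_zero_iff {T : H →L[ℂ] H} {x : H} : suppProj T x = 0 ↔ T x = 0 := by
  rw [suppProj, projOn_apply_eq_zero_iff, Submodule.orthogonal_orthogonal_eq_closure,
    T.isClosed_ker.submodule_topologicalClosure_eq]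
  rfl

theorem rangeProj_apply_eq_zero_iff {T : H →L[ℂ] H} {x : H} :
    rangeProj T x = 0 ↔ star T x = 0 := by
  rw [rangeProj, projOn_apply_eq_zero_iff, ContinuousLinearMap.orthogonal_range]
  rfl

theorem suppProj_star (T : H →L[ℂ] H) : suppProj (star T) = rangeProj T :=
  (isStarProjection_suppProj _).ext_ker (isStarProjection_rangeProj _) fun x => by
    rw [suppProj_apply_eq_zero_iff, rangeProj_apply_eq_zero_iff]

theorem rangeProj_star (T : H →L[ℂ] H) : rangeProj (star T) = suppProj T := by
  rw [← suppProj_star, star_star]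

theorem rangeProj_mul_self (T : H →L[ℂ] H) : rangeProj T * T = T := by
  ext x
  exact projOn_apply_eq_self ⟨x, rfl⟩

theorem mul_suppProj_self (T : H →L[ℂ] H) : T * suppProj T = T := by
  have := congrArg star (rangeProj_mul_self (star T))
  rwa [star_mul, star_star, rangeProj_star, (isStarProjection_suppProj T).star_eq] at this

theorem rangeProj_le {T F : H →L[ℂ] H} (hF : IsStarProjection F) (h : F * T = T) :
    rangeProj T ≤ F := by
  refine projOn_le hF ?_
  rintro _ ⟨x, rfl⟩
  exact DFunLike.congr_fun h x

theorem suppProj_le {T F : H →L[ℂ] H} (hF : IsStarProjection F) (h : T * F = T) :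
    suppProj T ≤ F := by
  rw [← rangeProj_star]
  refine rangeProj_le hF ?_
  rw [← hF.star_eq, ← star_mul, h]

/-- If `T = T Q`, the kernel of `T` in `Q(H)` is the complement of the support of `T` in `Q`. -/
theorem kerProjIn_eq {Q T : H →L[ℂ] H} (hQ : IsStarProjection Q) (h : T * Q = T) :
    kerProjIn Q T = Q - suppProj T := by
  have hle := suppProj_le hQ h
  have hcl : IsClosed ((T.ker ⊓ Q.range : Submodule ℂ H) : Set H) := by
    rw [Submodule.coe_inf]
    exact T.isClosed_ker.inter 
      (ContinuousLinearMap.IsIdempotentElem.isClosed_range hQ.isIdempotentElem)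
  refine (isStarProjection_projOn _).ext_forall
    (((isStarProjection_suppProj T).le_iff_sub hQ).1 hle) fun x => ?_
  rw [(isStarProjection_suppProj T).sub_apply_eq_self_iff hQ hle, suppProj_apply_eq_zero_iff,
    projOn_apply_eq_self_iff_of_isClosed hcl, Submodule.mem_inf, hQ.mem_range_iff,
    and_comm]
  rfl

/-! ### Membership in the von Neumann algebra -/

section VonNeumann

variable {N : VonNeumannAlgebra H}

theorem mem_of_forall_commute {X : H →L[ℂ] H} (h : ∀ A ∈ N.commutant, Commute A X) : X ∈ N := by
  rw [← VonNeumannAlgebra.commutant_commutant N, VonNeumannAlgebra.mem_commutant_iff]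
  exact h

theorem commute_of_mem {X A : H →L[ℂ] H} (hX : X ∈ N) (hA : A ∈ N.commutant) : Commute A X :=
  (VonNeumannAlgebra.mem_commutant_iff.1 hA X hX).symm

theorem cfc_mem {X : H →L[ℂ] H} (hX : X ∈ N) (f : ℝ → ℝ) : cfc f X ∈ N :=
  mem_of_forall_commute fun _ hA => ((commute_of_mem hX hA).symm.cfc_real f).symm

theorem absOp_mem {X : H →L[ℂ] H} (hX : X ∈ N) : absOp X ∈ N :=
  mem_of_forall_commute fun _ hA =>
    ((commute_of_mem hX hA).symm.cfcAbs_left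
      (commute_of_mem hX (star_mem hA)).symm).symm

theorem commute_rangeProj {B X : H →L[ℂ] H} (h : Commute B X) (h' : Commute (star B) X) :
    Commute B (rangeProj X) := by
  have hp := isStarProjection_rangeProj X
  have key : ∀ C : H →L[ℂ] H, Commute C X →
      rangeProj X * (C * rangeProj X) = C * rangeProj X := by
    intro C hC
    ext x
    have h2 : rangeProj X x ∈ X.range.topologicalClosure :=
      projOn_apply_eq_self_iff.1 (hp.apply_apply x)
    have h3 : Set.MapsTo C (X.range : Set H) X.range := by
      rintro _ ⟨y, rfl⟩
      exact ⟨C y, (DFunLike.congr_fun hC.eq y).symm⟩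
    exact projOn_apply_eq_self_iff.2 (h3.closure C.continuous h2)
  have h4 := congrArg star (key (star B) h')
  rw [star_mul, star_mul, star_star, hp.star_eq, mul_assoc, key B h] at h4
  exact h4

theorem IsProjIn.rangeProj {X : H →L[ℂ] H} (hX : X ∈ N) : IsProjIn N (rangeProj X) :=
  ⟨mem_of_forall_commute fun _ hA =>
    commute_rangeProj (commute_of_mem hX hA) (commute_of_mem hX (star_mem hA)),
    isStarProjection_rangeProj X⟩

theorem IsProjIn.suppProj {X : H →L[ℂ] H} (hX : X ∈ N) : IsProjIn N (suppProj X) := by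
  rw [← rangeProj_star]
  exact .rangeProj (star_mem hX)

theorem IsProjIn.sub {E F : H →L[ℂ] H} (hE : IsProjIn N E) (hF : IsProjIn N F) (h : E ≤ F) :
    IsProjIn N (F - E) :=
  ⟨sub_mem hF.1 hE.1, (hE.2.le_iff_sub hF.2).1 h⟩

theorem mem_corner_iff {P Q T : H →L[ℂ] H} (hP : IsProjIn N P) (hQ : IsProjIn N Q) :
    T ∈ corner N P Q ↔ T ∈ N ∧ P * T = T ∧ T * Q = T := by
  constructor
  · rintro ⟨A, hA, rfl⟩
    refine ⟨mul_mem (mul_mem hP.1 hA) hQ.1, ?_, ?_⟩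
    · rw [← mul_assoc, ← mul_assoc, hP.2.isIdempotentElem.eq]
    · rw [mul_assoc, hQ.2.isIdempotentElem.eq]
  · rintro ⟨h1, h2, h3⟩
    exact ⟨T, h1, by rw [h2, h3]⟩

end VonNeumann

/-! ### The polar decomposition -/

section Polar

variable {T V : H →L[ℂ] H}

theorem absOp_isSelfAdjoint (T : H →L[ℂ] H) : star (absOp T) = absOp T :=
  (CFC.abs_nonneg T).isSelfAdjoint.star_eq

theorem absOp_apply_eq_zero_iff {x : H} : absOp T x = 0 ↔ T x = 0 := by
  rw [← norm_eq_zero, norm_absOp_apply, norm_eq_zero]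

theorem suppProj_absOp (T : H →L[ℂ] H) : suppProj (absOp T) = suppProj T :=
  (isStarProjection_suppProj _).ext_ker (isStarProjection_suppProj _) fun x => by
    rw [suppProj_apply_eq_zero_iff, suppProj_apply_eq_zero_iff, absOp_apply_eq_zero_iff]

theorem rangeProj_absOp (T : H →L[ℂ] H) : rangeProj (absOp T) = suppProj T := by
  rw [← suppProj_star, absOp_isSelfAdjoint, suppProj_absOp]

namespace IsPolarDecomposition

theorem star_mul_self (h : IsPolarDecomposition T V) : star V * V = suppProj T := by
  have h1 := h.partial_isometry
  have hp : IsStarProjection (star V * V) :=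
    ⟨by rw [IsIdempotentElem, mul_assoc, ← mul_assoc V, h1], IsSelfAdjoint.star_mul_self V⟩
  refine hp.ext_ker (isStarProjection_suppProj _) fun x => ?_
  rw [suppProj_apply_eq_zero_iff]
  have h2 : T x = 0 ↔ V x = 0 := by
    have : x ∈ V.ker ↔ x ∈ T.ker := by rw [h.ker_eq]
    exact this.symm
  rw [h2]
  constructor
  · intro h3
    rw [← h1, mul_assoc, mul_apply_eq_comp, h3, map_zero]
  · intro h3
    rw [mul_apply_eq_comp, h3, map_zero]

theorem suppProj_eq (h : IsPolarDecomposition T V) : suppProj V = suppProj T :=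
  (isStarProjection_suppProj _).ext_ker (isStarProjection_suppProj _) fun x => by
    rw [suppProj_apply_eq_zero_iff, suppProj_apply_eq_zero_iff]
    exact (SetLike.ext_iff.1 h.ker_eq x)

theorem star_mul_eq_absOp (h : IsPolarDecomposition T V) : star V * T = absOp T := by
  conv_lhs => rw [h.eq_mul_abs]
  rw [← mul_assoc, h.star_mul_self, ← rangeProj_absOp, rangeProj_mul_self]

theorem star_eq_absOp_mul (h : IsPolarDecomposition T V) : star T = absOp T * star V := by
  conv_lhs => rw [h.eq_mul_abs]
  rw [star_mul, absOp_isSelfAdjoint]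

theorem rangeProj_eq (h : IsPolarDecomposition T V) : rangeProj V = rangeProj T := by
  refine (isStarProjection_rangeProj _).ext_ker (isStarProjection_rangeProj _) fun x => ?_
  rw [rangeProj_apply_eq_zero_iff, rangeProj_apply_eq_zero_iff, h.star_eq_absOp_mul,
    mul_apply_eq_comp, absOp_apply_eq_zero_iff]
  constructor
  · intro h1
    rw [h1, map_zero]
  · intro h1
    have h2 := congrArg star h.partial_isometry
    rw [star_mul, star_mul, star_star, ← mul_assoc, h.star_mul_self] at h2
    rw [← h2, mul_apply_eq_comp, suppProj_apply_eq_zero_iff, h1]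

theorem mul_star_self (h : IsPolarDecomposition T V) : V * star V = rangeProj T := by
  have h1 := h.partial_isometry
  have hp : IsStarProjection (V * star V) :=
    ⟨by rw [IsIdempotentElem, ← mul_assoc, h1], IsSelfAdjoint.mul_star_self V⟩
  refine le_antisymm ?_ (rangeProj_le hp ?_)
  · rw [hp.le_iff_mul_eq_right (isStarProjection_rangeProj _), ← h.rangeProj_eq, ← mul_assoc,
      rangeProj_mul_self]
  · conv_lhs => rw [h.eq_mul_abs]
    rw [← mul_assoc, h1, ← h.eq_mul_abs]

/-- The partial isometry of the polar decomposition of `T ∈ N` lies in `N`: it commutes with the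
commutant on the range of `|T|` because `T` and `|T|` do, and it vanishes on `ker T`. -/
theorem mem {N : VonNeumannAlgebra H} (h : IsPolarDecomposition T V) (hT : T ∈ N) : V ∈ N := by
  refine mem_of_forall_commute fun A hA => ?_
  have hS := commute_of_mem (IsProjIn.suppProj hT).1 hA
  have hVS : V * suppProj T = V := by rw [← h.suppProj_eq, mul_suppProj_self]
  -- `A V` and `V A` agree on the range of `|T|`, hence on its closure, the support of `T`.
  have h1 : ∀ x ∈ (absOp T).range.topologicalClosure, A (V x) = V (A x) := by
    intro x hx
    refine closure_minimal (s := ((absOp T).range : Set H)) (t := {x | A (V x) = V (A x)}) ?_ ?_ hx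
    · rintro _ ⟨y, rfl⟩
      have e1 : A (V (absOp T y)) = A (T y) :=
        congrArg A (DFunLike.congr_fun h.eq_mul_abs y).symm
      have e2 : V (absOp T (A y)) = T (A y) := (DFunLike.congr_fun h.eq_mul_abs (A y)).symm
      have e3 : A (T y) = T (A y) := DFunLike.congr_fun (commute_of_mem hT hA).eq y
      have e4 : A (absOp T y) = absOp T (A y) :=
        DFunLike.congr_fun (commute_of_mem (absOp_mem hT) hA).eq y
      change A (V (absOp T y)) = V (A (absOp T y))
      rw [e1, e3, e4, e2]
    · exact isClosed_eq (by fun_prop) (by fun_prop)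
  have h2 : A * V * suppProj T = V * A * suppProj T := by
    ext x
    refine h1 _ (projOn_apply_eq_self_iff.1 ?_)
    change rangeProj (absOp T) (suppProj T x) = suppProj T x
    rw [rangeProj_absOp, (isStarProjection_suppProj T).apply_apply]
  rw [mul_assoc, hVS, mul_assoc, hS.eq, ← mul_assoc, hVS] at h2
  exact h2

end IsPolarDecomposition

end Polar

/-! ### The trace -/

section Trace

variable {N : VonNeumannAlgebra H} {τ : (H →L[ℂ] H) → ℝ≥0∞}

namespace IsFNSTrace

theorem map_zero (hτ : IsFNSTrace N τ) : τ 0 = 0 := by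
  simpa using hτ.map_smul 0 0 (zero_mem N) le_rfl

theorem map_sub_add (hτ : IsFNSTrace N τ) {E F : H →L[ℂ] H} (hE : IsProjIn N E)
    (hF : IsProjIn N F) (h : E ≤ F) : τ F = τ (F - E) + τ E := by
  rw [← hτ.map_add _ (sub_mem hF.1 hE.1) (sub_nonneg.2 h) _ hE.1 hE.2.nonneg, sub_add_cancel]

theorem mono (hτ : IsFNSTrace N τ) {E F : H →L[ℂ] H} (hE : IsProjIn N E)
    (hF : IsProjIn N F) (h : E ≤ F) : τ E ≤ τ F := by
  rw [hτ.map_sub_add hE hF h]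
  exact le_add_self

theorem map_sub_add_sub (hτ : IsFNSTrace N τ) {E F G : H →L[ℂ] H} (hE : IsProjIn N E)
    (hF : IsProjIn N F) (hG : IsProjIn N G) (hEF : E ≤ F) (hFG : F ≤ G) :
    τ (G - E) = τ (G - F) + τ (F - E) := by
  rw [← hτ.map_add _ (sub_mem hG.1 hF.1) (sub_nonneg.2 hFG) _ (sub_mem hF.1 hE.1)
    (sub_nonneg.2 hEF), sub_add_sub_cancel]

/-- The range and support projections of an operator are Murray–von Neumann equivalent. -/
theorem map_suppProj_eq_map_rangeProj (hτ : IsFNSTrace N τ) {X : H →L[ℂ] H} (hX : X ∈ N) :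
    τ (suppProj X) = τ (rangeProj X) := by
  obtain ⟨V, hV⟩ := exists_isPolarDecomposition X
  rw [← hV.star_mul_self, ← hV.mul_star_self]
  exact hτ.trace V (hV.mem hX)

/-- If some `X ∈ N` maps `E(H)` injectively into `F(H)`, then `τ E ≤ τ F`. -/
theorem le_of_injOn (hτ : IsFNSTrace N τ) {X E F : H →L[ℂ] H} (hX : X ∈ N) (hE : IsProjIn N E)
    (hF : IsProjIn N F) (hmaps : ∀ x, E x = x → F (X x) = X x)
    (hinj : ∀ x, E x = x → X x = 0 → x = 0) : τ E ≤ τ F := by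
  have hXE : X * E ∈ N := mul_mem hX hE.1
  have h1 : suppProj (X * E) = E := by
    refine (isStarProjection_suppProj _).ext_ker hE.2 fun x => ?_
    rw [suppProj_apply_eq_zero_iff]
    constructor
    · intro h
      exact hinj _ (hE.2.apply_apply x) h
    · intro h
      rw [mul_apply_eq_comp, h, _root_.map_zero]
  rw [← h1, hτ.map_suppProj_eq_map_rangeProj hXE]
  refine hτ.mono (.rangeProj hXE) hF (rangeProj_le hF.2 ?_)
  ext x
  exact hmaps _ (hE.2.apply_apply x)

/-- A projection meeting trivially a projection `F₀ ≤ F` of finite cotrace in `F` has finite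
trace: `F - F₀` is injective on it. -/
theorem le_sub_of_disjoint (hτ : IsFNSTrace N τ) {E F₀ F : H →L[ℂ] H} (hE : IsProjIn N E)
    (hF₀ : IsProjIn N F₀) (hF : IsProjIn N F) (hEF : E ≤ F) (hle : F₀ ≤ F)
    (h : ∀ x, E x = x → F₀ x = x → x = 0) : τ E ≤ τ (F - F₀) := by
  have hs := hF₀.sub hF hle
  refine hτ.le_of_injOn hs.1 hE hs (fun x _ => hs.2.apply_apply x) fun x hx h0 => ?_
  have h1 : F x = x := (hE.2.le_iff_forall hF.2).1 hEF x hx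
  have h2 : x - F₀ x = 0 := by simpa [h1] using h0
  exact h x hx (sub_eq_zero.1 h2).symm

end IsFNSTrace

end Trace

/-! ### Spectral projections of positive operators -/

section Spectral

open MeasureTheory Filter Topology CompactlySupported

/-- The spectral measure of a self-adjoint operator `A` at `x`, obtained from the
Riesz–Markov–Kakutani theorem on the compact spectrum of `A` and pushed forward to `ℝ`. -/
theorem exists_spectralMeasure {A : H →L[ℂ] H} (hA : IsSelfAdjoint A) (x : H) :
    ∃ μ : Measure ℝ, IsFiniteMeasure μ ∧
      ∀ f : ℝ → ℝ, Continuous f → ((∫ t, f t ∂μ : ℝ) : ℂ) = inner ℂ x (cfc f A x) := by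
  let φ : C(spectrum ℝ A, ℝ) → ℝ := fun g => (inner ℂ x (cfcHom hA g x)).re
  let Λ : C_c(spectrum ℝ A, ℝ) →ₚ[ℝ] ℝ :=
    PositiveLinearMap.mk₀
      { toFun := fun g => φ g
        map_add' := fun g g' => by
          have : ((g + g' : C_c(spectrum ℝ A, ℝ)) : C(spectrum ℝ A, ℝ)) = g + g' := rfl
          simp only [φ, this, map_add, add_apply, inner_add_right, Complex.add_re]
        map_smul' := fun c g => by
          have : ((c • g : C_c(spectrum ℝ A, ℝ)) : C(spectrum ℝ A, ℝ)) = c • g := rfl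
          simp only [φ, this, map_smul]
          simp [inner_smul_right_eq_smul] }
      (fun g hg => by
        have h1 : 0 ≤ cfcHom hA (g : C(spectrum ℝ A, ℝ)) := (cfcHom_nonneg_iff hA).2 hg
        have h2 := ((ContinuousLinearMap.nonneg_iff_isPositive _).1 h1).re_inner_nonneg_right x
        exact h2)
  refine ⟨(RealRMK.rieszMeasure Λ).map Subtype.val, inferInstance, fun f hf => ?_⟩
  rw [integral_map measurable_subtype_coe.aemeasurable hf.aestronglyMeasurable]
  let g : C_c(spectrum ℝ A, ℝ) :=
    { toFun := fun t => f t
      hasCompactSupport' := HasCompactSupport.of_compactSpace _ }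
  have h1 : ∫ t : spectrum ℝ A, f t ∂(RealRMK.rieszMeasure Λ) = φ g :=
    RealRMK.integral_rieszMeasure Λ g
  have h2 : cfc f A = cfcHom hA (g : C(spectrum ℝ A, ℝ)) := cfc_apply f A
  have h3 : IsSelfAdjoint (cfc f A) := cfc_predicate f A
  rw [h1]
  simp only [φ]
  rw [← h2]
  have h4 := h3.isSymmetric.im_inner_self_apply x
  apply Complex.ext
  · simp
  · simpa using h4.symm

/-- The spectral projection `χ_{(δ, ∞)}(A)`, as the range projection of `(A - δ)₊`. -/
noncomputable def spectralProj (A : H →L[ℂ] H) (δ : ℝ) : H →L[ℂ] H :=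
  rangeProj (cfc (fun t : ℝ => max (t - δ) 0) A)

/-- `max(A, δ)⁻¹`, an inverse of `A` on the range of `χ_{(δ, ∞)}(A)`. -/
noncomputable def truncInv (A : H →L[ℂ] H) (δ : ℝ) : H →L[ℂ] H :=
  cfc (fun t : ℝ => (max t δ)⁻¹) A

variable {A : H →L[ℂ] H} {δ : ℝ}

theorem isStarProjection_spectralProj (A : H →L[ℂ] H) (δ : ℝ) :
    IsStarProjection (spectralProj A δ) :=
  isStarProjection_rangeProj _

theorem IsProjIn.spectralProj {N : VonNeumannAlgebra H} (hA : A ∈ N) (δ : ℝ) :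
    IsProjIn N (spectralProj A δ) :=
  .rangeProj (cfc_mem hA _)

theorem star_truncInv (A : H →L[ℂ] H) (δ : ℝ) : star (truncInv A δ) = truncInv A δ :=
  (cfc_predicate (p := IsSelfAdjoint) (fun t : ℝ => (max t δ)⁻¹) A).star_eq

theorem commute_spectralProj {B : H →L[ℂ] H} (hB : IsSelfAdjoint B) (h : Commute A B) :
    Commute B (spectralProj A δ) :=
  commute_rangeProj (h.cfc_real _).symm (by rw [hB.star_eq]; exact (h.cfc_real _).symm)

theorem commute_truncInv (A : H →L[ℂ] H) (δ : ℝ) : Commute A (truncInv A δ) :=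
  ((Commute.refl A).cfc_real _).symm

theorem spectralProj_apply_eq_zero_iff {x : H} :
    spectralProj A δ x = 0 ↔ cfc (fun t : ℝ => max (t - δ) 0) A x = 0 := by
  rw [spectralProj, rangeProj_apply_eq_zero_iff,
    (cfc_predicate (p := IsSelfAdjoint) (fun t : ℝ => max (t - δ) 0) A).star_eq]

theorem continuous_inv_max (hδ : 0 < δ) : Continuous fun t : ℝ => (max t δ)⁻¹ :=
  (continuous_id.max continuous_const).inv₀ fun _ => (lt_max_of_lt_right hδ).ne'

/-- `max(A, δ)⁻¹ A` is the identity on the range of `χ_{(δ, ∞)}(A)`. -/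
theorem truncInv_mul_mul_spectralProj (hA : IsSelfAdjoint A) (hδ : 0 < δ) :
    truncInv A δ * A * spectralProj A δ = spectralProj A δ := by
  have hc := continuous_inv_max hδ
  have h1 : truncInv A δ * A * cfc (fun t : ℝ => max (t - δ) 0) A =
      cfc (fun t : ℝ => max (t - δ) 0) A := by
    conv_lhs => rw [truncInv]; enter [1, 2]; rw [← cfc_id' ℝ A]
    have hc' : Continuous fun t : ℝ => (max t δ)⁻¹ * t := hc.mul continuous_id'
    rw [← cfc_mul _ _ A hc.continuousOn (by fun_prop),
      ← cfc_mul (fun t : ℝ => (max t δ)⁻¹ * t) _ A hc'.continuousOn (by fun_prop)]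
    refine cfc_congr fun t _ => ?_
    rcases le_total t δ with h | h
    · simp [max_eq_right (sub_nonpos.2 h)]
    · simp [max_eq_left h, inv_mul_cancel₀ (hδ.trans_le h).ne']
  have h2 : ∀ x, spectralProj A δ x = x → (truncInv A δ * A) x = x := by
    intro x hx
    refine closure_minimal (s := ((cfc (fun t : ℝ => max (t - δ) 0) A).range : Set H))
      (t := {x | (truncInv A δ * A) x = x}) ?_ ?_ (projOn_apply_eq_self_iff.1 hx)
    · rintro _ ⟨y, rfl⟩
      exact DFunLike.congr_fun h1 y
    · exact isClosed_eq (truncInv A δ * A).continuous continuous_id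
  ext x
  exact h2 _ ((isStarProjection_spectralProj A δ).apply_apply x)

/-- `A` is bounded by `δ` on the kernel of `χ_{(δ, ∞)}(A)`. -/
theorem norm_apply_le_of_spectralProj_eq_zero (hA : 0 ≤ A) (hδ : 0 < δ) {x : H}
    (hx : spectralProj A δ x = 0) : ‖A x‖ ≤ δ * ‖x‖ := by
  have hs := hA.isSelfAdjoint
  rw [spectralProj_apply_eq_zero_iff] at hx
  have h1 : cfc (fun t : ℝ => t - max (t - δ) 0) A = A - cfc (fun t : ℝ => max (t - δ) 0) A := by
    rw [cfc_sub (fun t : ℝ => t) _ A (by fun_prop) (by fun_prop), cfc_id' ℝ A]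
  have h2 : ‖cfc (fun t : ℝ => t - max (t - δ) 0) A‖ ≤ δ := by
    refine norm_cfc_le hδ.le fun t ht => ?_
    have h0 : 0 ≤ t := spectrum_nonneg_of_nonneg hA ht
    rw [Real.norm_eq_abs, abs_le]
    rcases max_cases (t - δ) 0 with h | h <;> constructor <;> linarith
  have h3 : A x = cfc (fun t : ℝ => t - max (t - δ) 0) A x := by
    rw [h1, sub_apply, hx, sub_zero]
  rw [h3]
  exact ContinuousLinearMap.le_of_opNorm_le _ h2 x

/-- A continuous approximation of the indicator function of `(δ, ∞)`: the function
`g / max(g, 1 / (n + 1))` with `g = (t - δ)₊`. It vanishes with `g` and equals `1` where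
`g ≥ 1 / (n + 1)`. -/
noncomputable def approxIndicator (δ : ℝ) (n : ℕ) (t : ℝ) : ℝ :=
  (max (max (t - δ) 0) (1 / ((n : ℝ) + 1)))⁻¹ * max (t - δ) 0

theorem continuous_approxIndicator (δ : ℝ) (n : ℕ) : Continuous (approxIndicator δ n) :=
  ((continuous_inv_max Nat.one_div_pos_of_nat).comp
    ((continuous_id.sub continuous_const).max continuous_const)).mul
    ((continuous_id.sub continuous_const).max continuous_const)

theorem norm_approxIndicator_le (δ : ℝ) (n : ℕ) (t : ℝ) : ‖approxIndicator δ n t‖ ≤ 1 := by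
  have h1 : 0 < 1 / ((n : ℝ) + 1) := Nat.one_div_pos_of_nat
  have h2 : 0 ≤ max (t - δ) 0 := le_max_right _ _
  rw [approxIndicator, Real.norm_eq_abs, abs_of_nonneg (by positivity),
    inv_mul_le_iff₀ (lt_max_of_lt_right h1), mul_one]
  exact le_max_left _ _

theorem approxIndicator_of_le {n : ℕ} {t : ℝ} (h : 1 / ((n : ℝ) + 1) ≤ t - δ) :
    approxIndicator δ n t = 1 := by
  have h1 : 0 < 1 / ((n : ℝ) + 1) := Nat.one_div_pos_of_nat
  rw [approxIndicator, max_eq_left (h1.le.trans h), max_eq_left h,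
    inv_mul_cancel₀ (h1.trans_le h).ne']

theorem tendsto_approxIndicator (δ t : ℝ) :
    Tendsto (fun n => approxIndicator δ n t) atTop (𝓝 ((Set.Ioi δ).indicator 1 t)) := by
  by_cases h : δ < t
  · rw [Set.indicator_of_mem (Set.mem_Ioi.2 h)]
    refine tendsto_const_nhds.congr' ?_
    have h1 : ∀ᶠ n : ℕ in atTop, 1 / ((n : ℝ) + 1) < t - δ :=
      tendsto_one_div_add_atTop_nhds_zero_nat.eventually_lt_const (sub_pos.2 h)
    filter_upwards [h1] with n hn
    rw [approxIndicator_of_le hn.le, Pi.one_apply]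
  · rw [Set.indicator_of_notMem (by simpa using h)]
    simp [approxIndicator, max_eq_right (sub_nonpos.2 (not_lt.1 h))]

/-- The operators `approxIndicator δ n` of `A` converge strongly to `χ_{(δ, ∞)}(A)`: they vanish on
its kernel, tend to the identity on the range of `(A - δ)₊`, and are uniformly bounded. -/
theorem tendsto_cfc_approxIndicator (A : H →L[ℂ] H) (δ : ℝ) (x : H) :
    Tendsto (fun n => cfc (approxIndicator δ n) A x) atTop (𝓝 (spectralProj A δ x)) := by
  set g : ℝ → ℝ := fun t => max (t - δ) 0 with hg
  have hgc : Continuous g := by fun_prop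
  have hnorm : ∀ n, ‖cfc (approxIndicator δ n) A‖ ≤ 1 := fun n =>
    norm_cfc_le zero_le_one fun t _ => norm_approxIndicator_le δ n t
  have hnear : ∀ n : ℕ, ‖cfc (approxIndicator δ n) A * cfc g A - cfc g A‖ ≤ 1 / ((n : ℝ) + 1) := by
    intro n
    have hc := continuous_approxIndicator δ n
    rw [← cfc_mul _ _ A hc.continuousOn hgc.continuousOn,
      ← cfc_sub _ _ A (by fun_prop) (by fun_prop)]
    have h1 : 0 < 1 / ((n : ℝ) + 1) := Nat.one_div_pos_of_nat
    refine norm_cfc_le h1.le fun t _ => ?_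
    have h0 : 0 ≤ g t := le_max_right _ _
    rcases le_total (1 / ((n : ℝ) + 1)) (t - δ) with h | h
    · rw [approxIndicator_of_le h]
      simpa using h1.le
    · have h2 : g t ≤ 1 / ((n : ℝ) + 1) := max_le h h1.le
      have h3 := norm_approxIndicator_le δ n t
      have h4 : 0 ≤ approxIndicator δ n t := by
        unfold approxIndicator; positivity
      rw [Real.norm_eq_abs, abs_of_nonneg h4] at h3
      rw [Real.norm_eq_abs, abs_le]
      constructor <;> nlinarith
  have hker : ∀ n, cfc (approxIndicator δ n) A (spectralProj A δ x) =
      cfc (approxIndicator δ n) A x := by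
    intro n
    have h1 : 0 < 1 / ((n : ℝ) + 1) := Nat.one_div_pos_of_nat
    have h2 : cfc (approxIndicator δ n) A =
        cfc (fun t => (max (g t) (1 / ((n : ℝ) + 1)))⁻¹) A * cfc g A := by
      have hc : Continuous fun t => (max (g t) (1 / ((n : ℝ) + 1)))⁻¹ :=
        (continuous_inv_max h1).comp hgc
      rw [← cfc_mul _ _ A hc.continuousOn hgc.continuousOn]
      rfl
    have h3 : spectralProj A δ (x - spectralProj A δ x) = 0 := by
      rw [map_sub, (isStarProjection_spectralProj A δ).apply_apply, sub_self]
    rw [spectralProj_apply_eq_zero_iff, map_sub, sub_eq_zero] at h3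
    rw [h2, mul_apply_eq_comp, mul_apply_eq_comp, h3]
  rw [Metric.tendsto_atTop]
  intro ε hε
  have hmem : spectralProj A δ x ∈ closure ((cfc g A).range : Set H) :=
    projOn_apply_eq_self_iff.1 ((isStarProjection_spectralProj A δ).apply_apply x)
  obtain ⟨_, ⟨y, rfl⟩, hy⟩ := Metric.mem_closure_iff.1 hmem (ε / 3) (by positivity)
  obtain ⟨n₀, hn₀⟩ := exists_nat_gt (3 * ‖y‖ / ε)
  refine ⟨n₀, fun n hn => ?_⟩
  rw [dist_eq_norm] at hy ⊢
  set e := spectralProj A δ x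
  set F := cfc (approxIndicator δ n) A with hF
  have e1 : F x - e = F (e - cfc g A y) + (F * cfc g A - cfc g A) y - (e - cfc g A y) := by
    rw [map_sub, sub_apply, mul_apply_eq_comp, hF, hker]
    abel
  have e2 : ‖F (e - cfc g A y)‖ < ε / 3 := by
    refine lt_of_le_of_lt ?_ hy
    simpa using ContinuousLinearMap.le_of_opNorm_le _ (hnorm n) (e - cfc g A y)
  have e3 : ‖(F * cfc g A - cfc g A) y‖ < ε / 3 := by
    refine lt_of_le_of_lt (ContinuousLinearMap.le_of_opNorm_le _ (hnear n) y) ?_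
    have h5 : (n₀ : ℝ) ≤ n := by exact_mod_cast hn
    rw [div_lt_iff₀ hε] at hn₀
    rw [one_div_mul_eq_div, div_lt_iff₀ (by positivity)]
    nlinarith
  rw [e1]
  calc _ ≤ ‖F (e - cfc g A y)‖ + ‖(F * cfc g A - cfc g A) y‖ + ‖e - cfc g A y‖ :=
        (norm_sub_le _ _).trans (by gcongr; exact norm_add_le _ _)
    _ < ε := by
      have : ‖e - cfc g A y‖ < ε / 3 := hy
      linarith

theorem isSpectralProjection_spectralProj (hA : IsSelfAdjoint A) (δ : ℝ) :
    IsSpectralProjection A (spectralProj A δ) := by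
  refine ⟨Set.Ioi δ, measurableSet_Ioi, fun x => ?_⟩
  obtain ⟨μ, hμ, hint⟩ := exists_spectralMeasure hA x
  refine ⟨μ, ⟨hμ, fun f hf _ => hint f hf⟩, ?_⟩
  have h1 : Tendsto (fun n => ∫ t, approxIndicator δ n t ∂μ) atTop
      (𝓝 (∫ t, (Set.Ioi δ).indicator 1 t ∂μ)) := by
    refine tendsto_integral_of_dominated_convergence (fun _ => 1)
      (fun n => (continuous_approxIndicator δ n).aestronglyMeasurable) (integrable_const _)
      (fun n => ae_of_all _ (norm_approxIndicator_le δ n))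
      (ae_of_all _ (tendsto_approxIndicator δ))
  rw [integral_indicator_one measurableSet_Ioi] at h1
  have h2 : Tendsto (fun n => inner ℂ x (cfc (approxIndicator δ n) A x)) atTop
      (𝓝 (inner ℂ x (spectralProj A δ x))) :=
    tendsto_const_nhds.inner (tendsto_cfc_approxIndicator A δ x)
  have h3 := (Complex.continuous_ofReal.tendsto _).comp h1
  refine tendsto_nhds_unique h2 (h3.congr fun n => ?_)
  exact hint _ (continuous_approxIndicator δ n)

end Spectral

/-! ### Operators bounded below on a subspace -/

section BoundedBelow

/-- By the open mapping theorem, `T*` is bounded below on every closed subspace contained in the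
range of `T`. -/
theorem exists_le_norm_star_apply {T F : H →L[ℂ] H} (hF : IsStarProjection F)
    (h : F.range ≤ T.range) : ∃ c > 0, ∀ x, F x = x → c * ‖x‖ ≤ ‖star T x‖ := by
  have hFc : IsClosed (F.range : Set H) :=
    ContinuousLinearMap.IsIdempotentElem.isClosed_range hF.isIdempotentElem
  let K : Submodule ℂ H := F.range.comap (T : H →ₗ[ℂ] H)
  have hKc : IsClosed (K : Set H) := hFc.preimage T.continuous
  have := hFc.completeSpace_coe
  have := hKc.completeSpace_coe
  let f : K →L[ℂ] F.range := (T ∘L K.subtypeL).codRestrict F.range fun x => x.2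
  have hf : Function.Surjective f := by
    rintro ⟨y, hy⟩
    obtain ⟨x, rfl⟩ := h hy
    exact ⟨⟨x, hy⟩, rfl⟩
  obtain ⟨C, hC, hpre⟩ := f.exists_preimage_norm_le hf
  refine ⟨C⁻¹, inv_pos.2 hC, fun x hx => ?_⟩
  obtain ⟨z, hz, hzn⟩ := hpre ⟨x, hF.mem_range_iff.2 hx⟩
  have hz' : T z = x := congrArg Subtype.val hz
  rw [inv_mul_le_iff₀ hC]
  rcases eq_or_ne x 0 with rfl | hx0
  · simp
  -- `‖x‖² = ⟪T* x, z⟫` for the bounded preimage `z` of `x`.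
  have h1 : ‖x‖ * ‖x‖ ≤ ‖star T x‖ * (C * ‖x‖) := by
    calc ‖x‖ * ‖x‖ = ‖inner ℂ (star T x) (z : H)‖ := by
          rw [inner_star_left, hz', inner_self_eq_norm_sq_to_K]
          simp [pow_two]
      _ ≤ ‖star T x‖ * ‖(z : H)‖ := norm_inner_le_norm _ _
      _ ≤ _ := by gcongr; exact hzn
  have h2 : 0 < ‖x‖ := norm_pos_iff.2 hx0
  refine le_of_mul_le_mul_right ?_ h2
  linarith

theorem isClosed_range_mul {X F : H →L[ℂ] H} (hF : IsStarProjection F) {c : ℝ} (hc : 0 < c)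
    (h : ∀ x, F x = x → c * ‖x‖ ≤ ‖X x‖) : IsClosed ((X * F).range : Set H) := by
  have hFc : IsClosed {x | F x = x} := isClosed_eq F.continuous continuous_id
  have h1 : ((X * F).range : Set H) = Set.range fun x : {x | F x = x} => X x := by
    ext y
    constructor
    · rintro ⟨x, rfl⟩
      exact ⟨⟨F x, hF.apply_apply x⟩, rfl⟩
    · rintro ⟨⟨x, hx⟩, rfl⟩
      refine ⟨x, ?_⟩
      change X (F x) = X x
      rw [show F x = x from hx]
  have := hFc.completeSpace_coe
  rw [h1]
  refine AntilipschitzWith.isClosed_range (K := ⟨c⁻¹, by positivity⟩) ?_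
    (X.uniformContinuous.comp uniformContinuous_subtype_val)
  refine AntilipschitzWith.of_le_mul_dist fun x y => ?_
  have h2 := h (x - y) (by rw [map_sub, show F x = x from x.2, show F y = y from y.2])
  rw [Subtype.dist_eq, dist_eq_norm, dist_eq_norm, ← map_sub]
  exact (le_inv_mul_iff₀ hc).2 h2

/-- If `X` is bounded below on `F(H)`, the projection onto `X F(H)` has range inside that of `X`. -/
theorem range_rangeProj_mul_le {X F : H →L[ℂ] H} (hF : IsStarProjection F) {c : ℝ} (hc : 0 < c)
    (h : ∀ x, F x = x → c * ‖x‖ ≤ ‖X x‖) : (rangeProj (X * F)).range ≤ X.range := by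
  intro x hx
  rw [(isStarProjection_rangeProj _).mem_range_iff, rangeProj,
    projOn_apply_eq_self_iff_of_isClosed (isClosed_range_mul hF hc h)] at hx
  obtain ⟨y, rfl⟩ := hx
  exact ⟨F y, rfl⟩

theorem RestrictsToInvertible.of_inverse {A B Q₀ P₀ : H →L[ℂ] H} (hQ : IsStarProjection Q₀)
    (hP : IsStarProjection P₀) (hA : P₀ * A * Q₀ = A * Q₀) (hB : Q₀ * B * P₀ = B * P₀)
    (hBA : B * A * Q₀ = Q₀) (hAB : A * B * P₀ = P₀) : RestrictsToInvertible A Q₀ P₀ := by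
  have key : ∀ {C E F : H →L[ℂ] H}, IsStarProjection E → IsStarProjection F →
      F * C * E = C * E → ∀ x : E.range, C x ∈ F.range := by
    intro C E F hE hF h x
    have h1 := DFunLike.congr_fun h (x : H)
    simp only [mul_apply_eq_comp, hE.mem_range_iff.1 x.2] at h1
    exact hF.mem_range_iff.2 h1
  let f : Q₀.range →L[ℂ] P₀.range :=
    (A ∘L Q₀.range.subtypeL).codRestrict P₀.range (key hQ hP hA)
  let g : P₀.range →L[ℂ] Q₀.range :=
    (B ∘L P₀.range.subtypeL).codRestrict Q₀.range (key hP hQ hB)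
  refine ⟨ContinuousLinearEquiv.equivOfInverse f g (fun x => ?_) fun x => ?_, fun x => rfl⟩
  · have h1 := DFunLike.congr_fun hBA (x : H)
    simp only [mul_apply_eq_comp, hQ.mem_range_iff.1 x.2] at h1
    exact Subtype.ext h1
  · have h1 := DFunLike.congr_fun hAB (x : H)
    simp only [mul_apply_eq_comp, hP.mem_range_iff.1 x.2] at h1
    exact Subtype.ext h1

end BoundedBelow

/-! ### Fredholm operators -/

section Fredholm

variable {N : VonNeumannAlgebra H} {τ : (H →L[ℂ] H) → ℝ≥0∞} {P Q T : H →L[ℂ] H}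

theorem mul_eq_of_rangeProj_le (hP : IsStarProjection P) (h : rangeProj T ≤ P) : P * T = T := by
  have h1 := ((isStarProjection_rangeProj T).le_iff_mul_eq_right hP).1 h
  rw [← rangeProj_mul_self T, ← mul_assoc, h1]

theorem mul_eq_of_suppProj_le (hQ : IsStarProjection Q) (h : suppProj T ≤ Q) : T * Q = T := by
  have h1 := ((isStarProjection_suppProj T).le_iff_mul_eq_left hQ).1 h
  rw [← mul_suppProj_self T, mul_assoc, h1]

theorem mem_corner_iff_le (hP : IsProjIn N P) (hQ : IsProjIn N Q) :
    T ∈ corner N P Q ↔ T ∈ N ∧ rangeProj T ≤ P ∧ suppProj T ≤ Q := by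
  rw [mem_corner_iff hP hQ]
  exact and_congr_right fun _ =>
    and_congr ⟨rangeProj_le hP.2, mul_eq_of_rangeProj_le hP.2⟩
      ⟨suppProj_le hQ.2, mul_eq_of_suppProj_le hQ.2⟩

theorem kerProjIn_star_eq (hP : IsStarProjection P) (h : rangeProj T ≤ P) :
    kerProjIn P (star T) = P - rangeProj T := by
  rw [← suppProj_star] at h ⊢
  exact kerProjIn_eq hP (mul_eq_of_suppProj_le hP h)

theorem index_eq (hP : IsProjIn N P) (hQ : IsProjIn N Q) (hT : T ∈ corner N P Q) :
    index τ P Q T = (τ (Q - suppProj T)).toReal - (τ (P - rangeProj T)).toReal := by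
  obtain ⟨-, h1, h2⟩ := (mem_corner_iff_le hP hQ).1 hT
  rw [index, kerProjIn_star_eq hP.2 h1, kerProjIn_eq hQ.2 (mul_eq_of_suppProj_le hQ.2 h2)]

/-- The Fredholm property in terms of the support and range projections, with the projection
`F = P - E` onto a subspace of the range of `T` in place of `E`. -/
theorem isFredholm_iff (hP : IsProjIn N P) (hQ : IsProjIn N Q) :
    IsFredholm N τ P Q T ↔ T ∈ corner N P Q ∧ τ (Q - suppProj T) < ∞ ∧
      τ (P - rangeProj T) < ∞ ∧
      ∃ F, IsProjIn N F ∧ F ≤ P ∧ τ (P - F) < ∞ ∧ F.range ≤ T.range := by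
  have key : T ∈ corner N P Q → kerProjIn Q T = Q - suppProj T ∧
      kerProjIn P (star T) = P - rangeProj T := fun h => by
    obtain ⟨-, h1, h2⟩ := (mem_corner_iff_le hP hQ).1 h
    exact ⟨kerProjIn_eq hQ.2 (mul_eq_of_suppProj_le hQ.2 h2), kerProjIn_star_eq hP.2 h1⟩
  constructor
  · rintro ⟨h, h1, h2, E, hE, hEP, hτE, hr⟩
    rw [(key h).1] at h1
    rw [(key h).2] at h2
    exact ⟨h, h1, h2, P - E, hE.sub hP hEP, sub_le_self _ hE.2.nonneg,
      by rwa [sub_sub_cancel], hr⟩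
  · rintro ⟨h, h1, h2, F, hF, hFP, hτF, hr⟩
    refine ⟨h, by rwa [(key h).1], by rwa [(key h).2], P - F, hF.sub hP hFP,
      sub_le_self _ hF.2.nonneg, hτF, by rwa [sub_sub_cancel]⟩

/-- A projection whose range lies in that of `T` is dominated by the range projection of `T`. -/
theorem le_rangeProj {F : H →L[ℂ] H} (hF : IsStarProjection F) (h : F.range ≤ T.range) :
    F ≤ rangeProj T :=
  (hF.le_iff_forall (isStarProjection_rangeProj T)).2 fun _ hx =>
    projOn_apply_eq_self (h (hF.mem_range_iff.2 hx))

theorem index_rangeProj_suppProj (hτ : IsFNSTrace N τ) (hT : T ∈ N) :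
    index τ (rangeProj T) (suppProj T) T = 0 := by
  have hR := IsProjIn.rangeProj hT
  have hS := IsProjIn.suppProj hT
  rw [index_eq hR hS ((mem_corner_iff_le hR hS).2 ⟨hT, le_rfl, le_rfl⟩), sub_self, sub_self,
    hτ.map_zero, sub_self]

theorem isFredholm_iff_rangeProj_suppProj (hτ : IsFNSTrace N τ) (hP : IsProjIn N P)
    (hQ : IsProjIn N Q) (hT : T ∈ corner N P Q) :
    IsFredholm N τ P Q T ↔ IsFredholm N τ (rangeProj T) (suppProj T) T ∧
      τ (Q - suppProj T) < ∞ ∧ τ (P - rangeProj T) < ∞ := by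
  obtain ⟨hN, hRP, hSQ⟩ := (mem_corner_iff_le hP hQ).1 hT
  have hR := IsProjIn.rangeProj hN
  have hS := IsProjIn.suppProj hN
  rw [isFredholm_iff hP hQ, isFredholm_iff hR hS]
  constructor
  · rintro ⟨-, h1, h2, F, hF, hFP, hτF, hr⟩
    have hFR := le_rangeProj hF.2 hr
    refine ⟨⟨(mem_corner_iff_le hR hS).2 ⟨hN, le_rfl, le_rfl⟩, ?_, ?_, F, hF, hFR, ?_, hr⟩, h1, h2⟩
    · rw [sub_self, hτ.map_zero]; exact ENNReal.zero_lt_top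
    · rw [sub_self, hτ.map_zero]; exact ENNReal.zero_lt_top
    · exact (hτ.mono (hF.sub hR hFR) (hF.sub hP hFP) (sub_le_sub_right hRP F)).trans_lt hτF
  · rintro ⟨⟨-, -, -, F, hF, hFR, hτF, hr⟩, h1, h2⟩
    refine ⟨hT, h1, h2, F, hF, hFR.trans hRP, ?_, hr⟩
    rw [hτ.map_sub_add_sub hF hR hP hFR hRP]
    exact ENNReal.add_lt_top.2 ⟨h2, hτF⟩

/-- The range of the adjoint of a Fredholm operator contains a closed subspace of finite
codimension: the image under `T*` of one contained in the range of `T`. -/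
theorem IsFredholm.exists_range_le_range_star (hτ : IsFNSTrace N τ) (hP : IsProjIn N P)
    (hQ : IsProjIn N Q) (h : IsFredholm N τ P Q T) :
    ∃ G, IsProjIn N G ∧ G ≤ Q ∧ τ (Q - G) < ∞ ∧ G.range ≤ (star T).range := by
  obtain ⟨hT, h1, -, F, hF, hFP, hτF, hr⟩ := (isFredholm_iff hP hQ).1 h
  obtain ⟨hN, hRP, hSQ⟩ := (mem_corner_iff_le hP hQ).1 hT
  have hS := IsProjIn.suppProj hN
  obtain ⟨c, hc, hbd⟩ := exists_le_norm_star_apply hF.2 hr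
  have hG : IsProjIn N (rangeProj (star T * F)) := .rangeProj (mul_mem (star_mem hN) hF.1)
  have hGS : rangeProj (star T * F) ≤ suppProj T := by
    refine rangeProj_le hS.2 ?_
    rw [← mul_assoc, ← rangeProj_star, rangeProj_mul_self]
  refine ⟨_, hG, hGS.trans hSQ, ?_, range_rangeProj_mul_le hF.2 hc hbd⟩
  rw [hτ.map_sub_add_sub hG hS hQ hGS hSQ]
  refine ENNReal.add_lt_top.2 ⟨h1, lt_of_le_of_lt ?_ hτF⟩
  -- `T` maps the complement of `T* F(H)` in the support of `T` injectively into `(P - F)(H)`.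
  refine hτ.le_of_injOn hN (hG.sub hS hGS) (hF.sub hP hFP) (fun x hx => ?_) fun x hx h0 => ?_
  · have h2 := ((hG.2.sub_apply_eq_self_iff hS.2 hGS).1 hx).2
    rw [rangeProj_apply_eq_zero_iff, star_mul, star_star, hF.2.star_eq] at h2
    refine (hF.2.sub_apply_eq_self_iff hP.2 hFP).2 ⟨?_, h2⟩
    exact DFunLike.congr_fun (mul_eq_of_rangeProj_le hP.2 hRP) x
  · have h2 := ((hG.2.sub_apply_eq_self_iff hS.2 hGS).1 hx).1
    rw [← h2, suppProj_apply_eq_zero_iff, h0]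

theorem mem_corner_star (hP : IsProjIn N P) (hQ : IsProjIn N Q) (h : T ∈ corner N P Q) :
    star T ∈ corner N Q P := by
  obtain ⟨hN, hRP, hSQ⟩ := (mem_corner_iff_le hP hQ).1 h
  rw [mem_corner_iff_le hQ hP, rangeProj_star, suppProj_star]
  exact ⟨star_mem hN, hSQ, hRP⟩

theorem IsFredholm.star (hτ : IsFNSTrace N τ) (hP : IsProjIn N P) (hQ : IsProjIn N Q)
    (h : IsFredholm N τ P Q T) : IsFredholm N τ Q P (star T) := by
  obtain ⟨hT, h1, h2, -⟩ := (isFredholm_iff hP hQ).1 h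
  refine (isFredholm_iff hQ hP).2 ⟨mem_corner_star hP hQ hT, ?_, ?_,
    h.exists_range_le_range_star hτ hP hQ⟩
  · rwa [suppProj_star]
  · rwa [rangeProj_star]

theorem index_star (τ : (H →L[ℂ] H) → ℝ≥0∞) (P Q T : H →L[ℂ] H) :
    index τ Q P (Star.star T) = -index τ P Q T := by
  rw [index, index, star_star, neg_sub]

namespace IsPolarDecomposition

variable {V : H →L[ℂ] H}

theorem mem_corner (hV : IsPolarDecomposition T V) (hP : IsProjIn N P) (hQ : IsProjIn N Q)
    (h : T ∈ corner N P Q) : V ∈ corner N P Q := by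
  obtain ⟨hN, hRP, hSQ⟩ := (mem_corner_iff_le hP hQ).1 h
  rw [mem_corner_iff_le hP hQ, hV.rangeProj_eq, hV.suppProj_eq]
  exact ⟨hV.mem hN, hRP, hSQ⟩

theorem isFredholm (hV : IsPolarDecomposition T V) (hP : IsProjIn N P) (hQ : IsProjIn N Q)
    (h : IsFredholm N τ P Q T) : IsFredholm N τ P Q V := by
  obtain ⟨hT, h1, h2, F, hF, hFP, hτF, hr⟩ := (isFredholm_iff hP hQ).1 h
  refine (isFredholm_iff hP hQ).2 ⟨hV.mem_corner hP hQ hT, by rwa [hV.suppProj_eq],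
    by rwa [hV.rangeProj_eq], F, hF, hFP, hτF, hr.trans ?_⟩
  rintro _ ⟨x, rfl⟩
  exact ⟨absOp T x, (DFunLike.congr_fun hV.eq_mul_abs x).symm⟩

theorem index_eq (hV : IsPolarDecomposition T V) (hP : IsProjIn N P) (hQ : IsProjIn N Q)
    (h : T ∈ corner N P Q) : index τ P Q V = index τ P Q T := by
  rw [SkewFredholm.index_eq hP hQ h, SkewFredholm.index_eq hP hQ (hV.mem_corner hP hQ h),
    hV.suppProj_eq, hV.rangeProj_eq]

end IsPolarDecomposition

theorem IsFredholm.absOp (hτ : IsFNSTrace N τ) (hP : IsProjIn N P) (hQ : IsProjIn N Q)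
    (h : IsFredholm N τ P Q T) : IsFredholm N τ Q Q (absOp T) := by
  obtain ⟨hT, h1, -⟩ := (isFredholm_iff hP hQ).1 h
  obtain ⟨hN, -, hSQ⟩ := (mem_corner_iff_le hP hQ).1 hT
  obtain ⟨G, hG, hGQ, hτG, hr⟩ := h.exists_range_le_range_star hτ hP hQ
  refine (isFredholm_iff hQ hQ).2 ⟨?_, ?_, ?_, G, hG, hGQ, hτG, hr.trans ?_⟩
  · rw [mem_corner_iff_le hQ hQ, rangeProj_absOp, suppProj_absOp]
    exact ⟨absOp_mem hN, hSQ, hSQ⟩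
  · rwa [suppProj_absOp]
  · rwa [rangeProj_absOp]
  · obtain ⟨V, hV⟩ := exists_isPolarDecomposition T
    rintro _ ⟨x, rfl⟩
    exact ⟨Star.star V x, (DFunLike.congr_fun hV.star_eq_absOp_mul x).symm⟩

theorem index_absOp (τ : (H →L[ℂ] H) → ℝ≥0∞) (Q T : H →L[ℂ] H) :
    index τ Q Q (SkewFredholm.absOp T) = 0 := by
  rw [index, absOp_isSelfAdjoint, sub_self]

/-- A spectral projection of `|T|` away from `0` has finite cotrace when `T` is Fredholm: its
complement meets trivially a projection on which `|T|` is bounded below. -/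
theorem IsFredholm.exists_spectralProj (hτ : IsFNSTrace N τ) (hP : IsProjIn N P)
    (hQ : IsProjIn N Q) (h : IsFredholm N τ P Q T) :
    ∃ δ > 0, spectralProj (SkewFredholm.absOp T) δ ≤ suppProj T ∧
      τ (Q - spectralProj (SkewFredholm.absOp T) δ) < ∞ := by
  obtain ⟨hT, -⟩ := (isFredholm_iff hP hQ).1 h
  obtain ⟨hN, -, hSQ⟩ := (mem_corner_iff_le hP hQ).1 hT
  obtain ⟨G, hG, hGQ, hτG, hr⟩ := h.exists_range_le_range_star hτ hP hQ
  obtain ⟨c, hc, hbd⟩ := exists_le_norm_star_apply hG.2 hr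
  rw [star_star] at hbd
  have hA := CFC.abs_nonneg T
  have hδ : 0 < c / 2 := half_pos hc
  have hE : IsProjIn N (spectralProj (SkewFredholm.absOp T) (c / 2)) :=
    .spectralProj (absOp_mem hN) _
  have hle : spectralProj (SkewFredholm.absOp T) (c / 2) ≤ suppProj T := by
    rw [hE.2.le_iff_mul_eq_right (isStarProjection_suppProj T)]
    conv_lhs => rw [← truncInv_mul_mul_spectralProj hA.isSelfAdjoint hδ]
    rw [← (commute_truncInv _ _).eq, ← mul_assoc, ← mul_assoc, ← rangeProj_absOp,
      rangeProj_mul_self, (commute_truncInv _ _).eq,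
      truncInv_mul_mul_spectralProj hA.isSelfAdjoint hδ]
  refine ⟨c / 2, hδ, hle, lt_of_le_of_lt ?_ hτG⟩
  refine hτ.le_sub_of_disjoint (hE.sub hQ (hle.trans hSQ)) hG hQ (sub_le_self _ hE.2.nonneg) hGQ
    fun x hx hGx => ?_
  have h1 := norm_apply_le_of_spectralProj_eq_zero hA hδ
    ((hE.2.sub_apply_eq_self_iff hQ.2 (hle.trans hSQ)).1 hx).2
  have h2 := hbd x hGx
  rw [norm_absOp_apply] at h1
  have h3 : ‖x‖ ≤ 0 := by nlinarith [norm_nonneg x]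
  exact norm_le_zero_iff.1 h3

/-- An operator bounded below on `Q₀(H)` whose compression `P₀ S Q₀` has dense range in `P₀(H)`
(stated as injectivity of `Q₀ S*` on `P₀(H)`) is Fredholm if `P₀` and `Q₀` have finite
cotrace. -/
theorem isFredholm_of_boundedBelow (hτ : IsFNSTrace N τ) (hP : IsProjIn N P) (hQ : IsProjIn N Q)
    {P₀ Q₀ S : H →L[ℂ] H} (hS : S ∈ corner N P Q) (hP₀ : IsProjIn N P₀) (hQ₀ : IsProjIn N Q₀)
    (hPle : P₀ ≤ P) (hQle : Q₀ ≤ Q) (hPfin : τ (P - P₀) < ∞) (hQfin : τ (Q - Q₀) < ∞)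
    {c : ℝ} (hc : 0 < c) (hbd : ∀ x, Q₀ x = x → c * ‖x‖ ≤ ‖S x‖)
    (hinj : ∀ x, P₀ x = x → Q₀ (star S x) = 0 → x = 0) : IsFredholm N τ P Q S := by
  obtain ⟨hN, hRP, hSQ⟩ := (mem_corner_iff_le hP hQ).1 hS
  have hR := IsProjIn.rangeProj hN
  have hSu := IsProjIn.suppProj hN
  have hG : IsProjIn N (rangeProj (S * Q₀)) := .rangeProj (mul_mem hN hQ₀.1)
  have hGP : rangeProj (S * Q₀) ≤ P := by
    refine rangeProj_le hP.2 ?_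
    rw [← mul_assoc, mul_eq_of_rangeProj_le hP.2 hRP]
  refine (isFredholm_iff hP hQ).2 ⟨hS, lt_of_le_of_lt ?_ hQfin, lt_of_le_of_lt ?_ hPfin,
    _, hG, hGP, lt_of_le_of_lt ?_ hPfin, range_rangeProj_mul_le hQ₀.2 hc hbd⟩
  · refine hτ.le_sub_of_disjoint (hSu.sub hQ hSQ) hQ₀ hQ (sub_le_self _ hSu.2.nonneg) hQle
      fun x hx hx₀ => ?_
    have h1 := ((hSu.2.sub_apply_eq_self_iff hQ.2 hSQ).1 hx).2
    have h2 := hbd x hx₀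
    rw [suppProj_apply_eq_zero_iff.1 h1, norm_zero] at h2
    exact norm_le_zero_iff.1 (nonpos_of_mul_nonpos_right h2 hc)
  · refine hτ.le_sub_of_disjoint (hR.sub hP hRP) hP₀ hP (sub_le_self _ hR.2.nonneg) hPle
      fun x hx hx₀ => hinj x hx₀ ?_
    have h1 := ((hR.2.sub_apply_eq_self_iff hP.2 hRP).1 hx).2
    rw [rangeProj_apply_eq_zero_iff.1 h1, map_zero]
  · refine hτ.le_sub_of_disjoint (hG.sub hP hGP) hP₀ hP (sub_le_self _ hG.2.nonneg) hPle
      fun x hx hx₀ => hinj x hx₀ ?_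
    have h1 := ((hG.2.sub_apply_eq_self_iff hP.2 hGP).1 hx).2
    rw [rangeProj_apply_eq_zero_iff, star_mul, hQ₀.2.star_eq] at h1
    exact h1

end Fredholm

/-! ### Invertible restrictions to spectral subspaces -/

section Restriction

variable {N : VonNeumannAlgebra H} {τ : (H →L[ℂ] H) → ℝ≥0∞} {P Q T V : H →L[ℂ] H}

namespace IsPolarDecomposition

/-- The partial isometry `V` carries a projection `Q₀` in its initial space to `V Q₀ V*`. -/
theorem isProjIn_conj (hV : IsPolarDecomposition T V) (hT : T ∈ N) {Q₀ : H →L[ℂ] H}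
    (hQ₀ : IsProjIn N Q₀) (hle : Q₀ ≤ suppProj T) : IsProjIn N (V * Q₀ * star V) := by
  have hVN := hV.mem hT
  have h1 := (hQ₀.2.le_iff_mul_eq_right (isStarProjection_suppProj T)).1 hle
  rw [← hV.star_mul_self] at h1
  refine ⟨mul_mem (mul_mem hVN hQ₀.1) (star_mem hVN), ?_, ?_⟩
  · calc V * Q₀ * star V * (V * Q₀ * star V) = V * Q₀ * (star V * V * Q₀) * star V := by
          simp only [mul_assoc]
      _ = V * Q₀ * star V := by rw [h1, mul_assoc V, hQ₀.2.isIdempotentElem.eq]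
  · rw [IsSelfAdjoint, star_mul, star_mul, star_star, hQ₀.2.star_eq, mul_assoc]

theorem conj_le (hV : IsPolarDecomposition T V) (hT : T ∈ N) {Q₀ : H →L[ℂ] H}
    (hQ₀ : IsProjIn N Q₀) (hle : Q₀ ≤ suppProj T) : V * Q₀ * star V ≤ rangeProj T := by
  rw [(hV.isProjIn_conj hT hQ₀ hle).2.le_iff_mul_eq_right (isStarProjection_rangeProj T),
    ← hV.rangeProj_eq, ← mul_assoc, ← mul_assoc, rangeProj_mul_self]

theorem map_sub_conj_le (hV : IsPolarDecomposition T V) (hτ : IsFNSTrace N τ) (hT : T ∈ N)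
    {Q₀ : H →L[ℂ] H} (hQ₀ : IsProjIn N Q₀) (hle : Q₀ ≤ suppProj T) :
    τ (rangeProj T - V * Q₀ * star V) ≤ τ (suppProj T - Q₀) := by
  have hP₀ := hV.isProjIn_conj hT hQ₀ hle
  have hc := hV.conj_le hT hQ₀ hle
  have hR := IsProjIn.rangeProj hT
  have hS := IsProjIn.suppProj hT
  have h1 := (hQ₀.2.le_iff_mul_eq_right hS.2).1 hle
  have h2 : star V * (rangeProj T - V * Q₀ * star V) =
      (suppProj T - Q₀) * star V := by
    rw [mul_sub, sub_mul, ← hV.mul_star_self, ← mul_assoc, ← mul_assoc, ← mul_assoc,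
      hV.star_mul_self, h1]
  refine hτ.le_of_injOn (star_mem (hV.mem hT)) (hP₀.sub hR hc) (hQ₀.sub hS hle) (fun x hx => ?_)
    fun x hx h0 => ?_
  · have h3 : star V x = (suppProj T - Q₀) (star V x) := by
      conv_lhs => rw [← hx]
      exact DFunLike.congr_fun h2 x
    exact h3.symm
  · have h3 := ((hP₀.2.sub_apply_eq_self_iff hR.2 hc).1 hx).1
    rw [← h3, ← hV.mul_star_self, mul_apply_eq_comp, h0, map_zero]

end IsPolarDecomposition

/-- The algebraic relations between `T = V|T|`, a spectral projection `Q₀` of `|T|`, its image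
`P₀ = V Q₀ V*`, and the inverse `R = max(|T|, δ)⁻¹ V*` of `T : Q₀(H) → P₀(H)`. -/
theorem IsPolarDecomposition.exists_inverse (hV : IsPolarDecomposition T V) {δ : ℝ} (hδ : 0 < δ)
    {P₀ Q₀ : H →L[ℂ] H} (hQ₀ : Q₀ = spectralProj (absOp T) δ) (hle : Q₀ ≤ suppProj T)
    (hP₀ : P₀ = V * Q₀ * star V) :
    P₀ * T = T * Q₀ ∧ ∃ R : H →L[ℂ] H, R * T * Q₀ = Q₀ ∧ T * Q₀ * R = P₀ ∧
      R * P₀ = Q₀ * R := by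
  have hA := (CFC.abs_nonneg T).isSelfAdjoint
  have hp : IsStarProjection Q₀ := hQ₀ ▸ isStarProjection_spectralProj _ _
  have hSQ := (hp.le_iff_mul_eq_right (isStarProjection_suppProj T)).1 hle
  rw [← hV.star_mul_self] at hSQ
  set K := truncInv (absOp T) δ
  have hKA : K * absOp T * Q₀ = Q₀ := hQ₀ ▸ truncInv_mul_mul_spectralProj hA hδ
  have hAQ : absOp T * Q₀ = Q₀ * absOp T :=
    hQ₀ ▸ (commute_spectralProj hA (Commute.refl _)).eq
  have hKQ : K * Q₀ = Q₀ * K :=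
    hQ₀ ▸ (commute_spectralProj (star_truncInv _ _) (commute_truncInv _ _)).eq
  have hAK : absOp T * K = K * absOp T := (commute_truncInv _ _).eq
  have hPT : P₀ * T = T * Q₀ := by
    rw [hP₀, mul_assoc, hV.star_mul_eq_absOp, mul_assoc, ← hAQ, ← mul_assoc, ← hV.eq_mul_abs]
  refine ⟨hPT, K * star V, ?_, ?_, ?_⟩
  · rw [mul_assoc K, hV.star_mul_eq_absOp, hKA]
  · have h1 : T * Q₀ * K = V * Q₀ := by
      calc T * Q₀ * K = T * (K * Q₀) := by rw [mul_assoc, hKQ]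
        _ = V * (absOp T * K) * Q₀ := by
          conv_lhs => rw [hV.eq_mul_abs]
          simp only [mul_assoc]
        _ = V * Q₀ := by rw [hAK, mul_assoc, hKA]
    rw [← mul_assoc, h1, hP₀]
  · rw [hP₀, mul_assoc K, ← mul_assoc (star V), ← mul_assoc (star V), hSQ, ← mul_assoc, hKQ,
      mul_assoc]

theorem star_mul_eq_of_mul_eq {P₀ Q₀ : H →L[ℂ] H} (hP₀ : IsStarProjection P₀)
    (hQ₀ : IsStarProjection Q₀) (h : P₀ * T = T * Q₀) : star T * P₀ = Q₀ * star T := by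
  have := congrArg star h
  rwa [star_mul, star_mul, hP₀.star_eq, hQ₀.star_eq] at this

theorem range_le_of_inverse {P₀ Q₀ R : H →L[ℂ] H} (hP₀ : IsStarProjection P₀)
    (hQ₀ : IsStarProjection Q₀) (hPT : P₀ * T = T * Q₀) (hRT : R * T * Q₀ = Q₀)
    (hTR : T * Q₀ * R = P₀) : P₀.range ≤ T.range ∧ Q₀.range ≤ (star T).range := by
  constructor
  · rintro _ ⟨x, rfl⟩
    exact ⟨Q₀ (R x), DFunLike.congr_fun hTR x⟩
  · have h1 : star T * (P₀ * star R) = Q₀ := by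
      have h2 := congrArg star hRT
      rwa [mul_assoc, ← hPT, star_mul, star_mul, hP₀.star_eq, hQ₀.star_eq, mul_assoc] at h2
    rintro _ ⟨x, rfl⟩
    exact ⟨P₀ (star R x), DFunLike.congr_fun h1 x⟩

/-- The inverse `R` of `T : Q₀(H) → P₀(H)` makes `T Q₀` and, by taking adjoints, `T* P₀`
invertible. -/
theorem restrictsToInvertible_of_inverse {P₀ Q₀ R : H →L[ℂ] H} (hP₀ : IsStarProjection P₀)
    (hQ₀ : IsStarProjection Q₀) (hPT : P₀ * T = T * Q₀) (hRT : R * T * Q₀ = Q₀)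
    (hTR : T * Q₀ * R = P₀) (hRP : R * P₀ = Q₀ * R) :
    RestrictsToInvertible (T * Q₀) Q₀ P₀ ∧ RestrictsToInvertible (star T * P₀) P₀ Q₀ := by
  have hP := hP₀.isIdempotentElem.eq
  have hQ := hQ₀.isIdempotentElem.eq
  have hPT' := star_mul_eq_of_mul_eq hP₀ hQ₀ hPT
  have hRP' := star_mul_eq_of_mul_eq hQ₀ hP₀ hRP.symm
  have hRT' : star T * P₀ * star R = Q₀ := by
    have := congrArg star hRT
    rwa [mul_assoc, star_mul, star_mul, hQ₀.star_eq, ← hPT'] at this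
  have hTR' : star R * star T * P₀ = P₀ := by
    have := congrArg star hTR
    rwa [star_mul, star_mul, hP₀.star_eq, hQ₀.star_eq, ← hPT', ← mul_assoc] at this
  constructor
  · refine .of_inverse (B := R) hQ₀ hP₀ ?_ ?_ ?_ ?_
    · rw [← hPT, ← mul_assoc, hP]
    · rw [mul_assoc, hRP, ← mul_assoc, hQ]
    · rw [mul_assoc, mul_assoc T, hQ, ← mul_assoc, hRT]
    · rw [hTR, hP]
  · refine .of_inverse (B := star R) hP₀ hQ₀ ?_ ?_ ?_ ?_
    · rw [hPT', ← mul_assoc, hQ]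
    · rw [mul_assoc, hRP', ← mul_assoc, hP]
    · rw [mul_assoc, mul_assoc (star T), hP, ← mul_assoc, hTR']
    · rw [hRT', hQ]

theorem IsFredholm.map_sub_conj_lt_top (h : IsFredholm N τ P Q T) (hτ : IsFNSTrace N τ)
    (hP : IsProjIn N P) (hQ : IsProjIn N Q) (hV : IsPolarDecomposition T V) {Q₀ : H →L[ℂ] H}
    (hQ₀ : IsProjIn N Q₀) (hle : Q₀ ≤ suppProj T) (hfin : τ (Q - Q₀) < ∞) :
    τ (P - V * Q₀ * Star.star V) < ∞ := by
  obtain ⟨hT, -, h2, -⟩ := (isFredholm_iff hP hQ).1 h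
  obtain ⟨hN, hRP, hSQ⟩ := (mem_corner_iff_le hP hQ).1 hT
  have hS := IsProjIn.suppProj hN
  rw [hτ.map_sub_add_sub (hV.isProjIn_conj hN hQ₀ hle) (.rangeProj hN) hP
    (hV.conj_le hN hQ₀ hle) hRP]
  refine ENNReal.add_lt_top.2 ⟨h2, (hV.map_sub_conj_le hτ hN hQ₀ hle).trans_lt ?_⟩
  exact (hτ.mono (hQ₀.sub hS hle) (hQ₀.sub hQ (hle.trans hSQ))
    (sub_le_sub_right hSQ Q₀)).trans_lt hfin

end Restriction

/-! ### Openness -/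

section Open

variable {N : VonNeumannAlgebra H} {τ : (H →L[ℂ] H) → ℝ≥0∞} {P Q : H →L[ℂ] H}

/-- A Fredholm operator `T` and the compression `Q₀ T*` of its adjoint are bounded below on
`Q₀(H)` and `P₀(H)`, for suitable projections `Q₀` and `P₀` of finite cotrace. -/
theorem IsFredholm.exists_boundedBelow (hτ : IsFNSTrace N τ) (hP : IsProjIn N P)
    (hQ : IsProjIn N Q) {T : H →L[ℂ] H} (h : IsFredholm N τ P Q T) :
    ∃ P₀ Q₀, IsProjIn N P₀ ∧ IsProjIn N Q₀ ∧ P₀ ≤ P ∧ Q₀ ≤ Q ∧ τ (P - P₀) < ∞ ∧ τ (Q - Q₀) < ∞ ∧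
      ∃ c > 0, (∀ x, Q₀ x = x → c * ‖x‖ ≤ ‖T x‖) ∧
        ∀ x, P₀ x = x → c * ‖x‖ ≤ ‖Q₀ (Star.star T x)‖ := by
  obtain ⟨hT, -⟩ := (isFredholm_iff hP hQ).1 h
  obtain ⟨hN, hRP, hSQ⟩ := (mem_corner_iff_le hP hQ).1 hT
  obtain ⟨V, hV⟩ := exists_isPolarDecomposition T
  obtain ⟨δ, hδ, hle, hfin⟩ := h.exists_spectralProj hτ hP hQ
  set Q₀ := spectralProj (SkewFredholm.absOp T) δ with hQ₀d
  have hQ₀ : IsProjIn N Q₀ := .spectralProj (absOp_mem hN) _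
  have hP₀ := hV.isProjIn_conj hN hQ₀ hle
  obtain ⟨hPT, R, hRT, hTR, -⟩ := hV.exists_inverse hδ hQ₀d hle rfl
  obtain ⟨hr, hr'⟩ := range_le_of_inverse hP₀.2 hQ₀.2 hPT hRT hTR
  obtain ⟨c, hc, hb⟩ := exists_le_norm_star_apply hQ₀.2 hr'
  obtain ⟨c', hc', hb'⟩ := exists_le_norm_star_apply hP₀.2 hr
  rw [star_star] at hb
  refine ⟨_, Q₀, hP₀, hQ₀, (hV.conj_le hN hQ₀ hle).trans hRP, hle.trans hSQ,
    h.map_sub_conj_lt_top hτ hP hQ hV hQ₀ hle hfin, hfin, min c c', lt_min hc hc',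
    fun x hx => (hb x hx).trans' (by gcongr; exact min_le_left _ _), fun x hx => ?_⟩
  have h1 : Q₀ (Star.star T x) = Star.star T x := by
    have h2 := DFunLike.congr_fun (star_mul_eq_of_mul_eq hP₀.2 hQ₀.2 hPT) x
    rw [mul_apply_eq_comp, hx] at h2
    exact h2.symm
  rw [h1]
  exact (hb' x hx).trans' (by gcongr; exact min_le_right _ _)

theorem isOpen_isFredholm (hτ : IsFNSTrace N τ) (hP : IsProjIn N P) (hQ : IsProjIn N Q) :
    IsOpen {S : corner N P Q | IsFredholm N τ P Q (S : H →L[ℂ] H)} := by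
  rw [Metric.isOpen_iff]
  rintro ⟨T, hTc⟩ hT
  obtain ⟨P₀, Q₀, hP₀, hQ₀, hPle, hQle, hPfin, hQfin, c, hc, hb, hb'⟩ :=
    IsFredholm.exists_boundedBelow hτ hP hQ hT
  refine ⟨c, hc, ?_⟩
  rintro ⟨S, hS⟩ hST
  have hST' : ‖S - T‖ < c := by
    rw [← dist_eq_norm]
    exact hST
  have hn : ∀ x, ‖(S - T) x‖ ≤ ‖S - T‖ * ‖x‖ := (S - T).le_opNorm
  have hn' : ∀ x, ‖star (S - T) x‖ ≤ ‖S - T‖ * ‖x‖ := fun x =>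
    ContinuousLinearMap.le_of_opNorm_le _ (norm_star _).le x
  refine isFredholm_of_boundedBelow hτ hP hQ hS hP₀ hQ₀ hPle hQle hPfin hQfin
    (sub_pos.2 hST') (fun x hx => ?_) fun x hx h0 => ?_
  · have h1 := hb x hx
    have h2 : ‖T x‖ ≤ ‖S x‖ + ‖(S - T) x‖ := by
      have : T x = S x - (S - T) x := by rw [sub_apply, sub_sub_cancel]
      rw [this]
      exact norm_sub_le _ _
    have h3 := hn x
    rw [sub_mul]
    linarith
  · have h1 := hb' x hx
    have h2 : ‖Q₀ (star T x)‖ ≤ ‖S - T‖ * ‖x‖ := by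
      have : Q₀ (star T x) = -Q₀ (star (S - T) x) := by
        rw [star_sub, sub_apply, map_sub, h0, zero_sub, neg_neg]
      rw [this, norm_neg]
      exact (hQ₀.2.norm_apply_le _).trans (hn' x)
    have h3 : (c - ‖S - T‖) * ‖x‖ ≤ 0 := by rw [sub_mul]; linarith
    exact norm_le_zero_iff.1 (nonpos_of_mul_nonpos_right h3 (sub_pos.2 hST'))

end Open

end SkewFredholm

open SkewFredholm in
theorem lemma3p2 {H : Type*} [NormedAddCommGroup H] [InnerProductSpace ℂ H] [CompleteSpace H]
    (N : VonNeumannAlgebra H) (τ : (H →L[ℂ] H) → ENNReal) (hτ : IsFNSTrace N τ)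
    (P Q : H →L[ℂ] H) (hP : IsProjIn N P) (hQ : IsProjIn N Q) :
    (∀ T ∈ corner N P Q,
      -- (1)
      (∀ P₁ Q₁ : H →L[ℂ] H, P₁ = rangeProj T → Q₁ = Q - kerProjIn Q T →
        (Q₁ = suppProj T ∧ Q₁ = rangeProj (star T)) ∧
        (IsProjIn N P₁ ∧ P₁ ≤ P ∧ IsProjIn N Q₁ ∧ Q₁ ≤ Q) ∧
        (IsFredholm N τ P Q T ↔
          IsFredholm N τ P₁ Q₁ T ∧ τ (Q - Q₁) < ⊤ ∧ τ (P - P₁) < ⊤) ∧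
        (IsFredholm N τ P₁ Q₁ T → index τ P₁ Q₁ T = 0) ∧
        (IsFredholm N τ P Q T →
          index τ P Q T = (τ (Q - Q₁)).toReal - (τ (P - P₁)).toReal)) ∧
      -- (2)
      (IsFredholm N τ P Q T →
        IsFredholm N τ Q P (star T) ∧ index τ Q P (star T) = - index τ P Q T) ∧
      (IsFredholm N τ P Q T → ∀ V : H →L[ℂ] H, IsPolarDecomposition T V →
        IsFredholm N τ P Q V ∧ index τ P Q V = index τ P Q T ∧
        IsFredholm N τ Q Q (absOp T) ∧ index τ Q Q (absOp T) = 0) ∧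
      -- (3)
      (IsFredholm N τ P Q T → ∀ V : H →L[ℂ] H, IsPolarDecomposition T V →
        ∃ Q₀ : H →L[ℂ] H, IsProjIn N Q₀ ∧ IsSpectralProjection (absOp T) Q₀ ∧ Q₀ ≤ Q ∧
          τ (Q - Q₀) < ⊤ ∧
          ∀ P₀ : H →L[ℂ] H, P₀ = V * Q₀ * star V →
            IsProjIn N P₀ ∧ P₀ ≤ P ∧ τ (P - P₀) < ⊤ ∧
            P₀.range = (T * Q₀).range ∧ (T * Q₀).range ≤ T.range ∧
            Q₀.range ≤ (star T).range ∧
            T * Q₀ = P₀ * T * Q₀ ∧ RestrictsToInvertible (T * Q₀) Q₀ P₀ ∧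
            star T * P₀ = Q₀ * star T * P₀ ∧
            RestrictsToInvertible (star T * P₀) P₀ Q₀)) ∧
    -- (4)
    IsOpen {S : corner N P Q | IsFredholm N τ P Q (S : H →L[ℂ] H)} := by
  refine ⟨fun T hT => ⟨?_, fun h => ⟨h.star hτ hP hQ, index_star τ P Q T⟩, fun h V hV => ?_,
    fun h V hV => ?_⟩, isOpen_isFredholm hτ hP hQ⟩
  all_goals obtain ⟨hN, hRP, hSQ⟩ := (mem_corner_iff_le hP hQ).1 hT
  · rintro P₁ Q₁ rfl rfl
    have hQ₁ : Q - kerProjIn Q T = suppProj T := by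
      rw [kerProjIn_eq hQ.2 (mul_eq_of_suppProj_le hQ.2 hSQ), sub_sub_cancel]
    rw [hQ₁]
    exact ⟨⟨rfl, (rangeProj_star T).symm⟩, ⟨.rangeProj hN, hRP, .suppProj hN, hSQ⟩,
      isFredholm_iff_rangeProj_suppProj hτ hP hQ hT, fun _ => index_rangeProj_suppProj hτ hN,
      fun _ => index_eq hP hQ hT⟩
  · exact ⟨hV.isFredholm hP hQ h, hV.index_eq hP hQ hT, h.absOp hτ hP hQ, index_absOp τ Q T⟩
  · obtain ⟨δ, hδ, hle, hfin⟩ := h.exists_spectralProj hτ hP hQ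
    have hQ₀ : IsProjIn N (spectralProj (absOp T) δ) := .spectralProj (absOp_mem hN) _
    refine ⟨spectralProj (absOp T) δ, hQ₀,
      isSpectralProjection_spectralProj (CFC.abs_nonneg T).isSelfAdjoint δ, hle.trans hSQ, hfin,
      fun P₀ hP₀d => ?_⟩
    obtain ⟨hPT, R, hRT, hTR, hRP₀⟩ := hV.exists_inverse hδ rfl hle hP₀d
    have hP₀ : IsProjIn N P₀ := hP₀d ▸ hV.isProjIn_conj hN hQ₀ hle
    obtain ⟨hinv, hinv'⟩ := restrictsToInvertible_of_inverse hP₀.2 hQ₀.2 hPT hRT hTR hRP₀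
    have hPT' := star_mul_eq_of_mul_eq hP₀.2 hQ₀.2 hPT
    refine ⟨hP₀, hP₀d ▸ (hV.conj_le hN hQ₀ hle).trans hRP,
      hP₀d ▸ h.map_sub_conj_lt_top hτ hP hQ hV hQ₀ hle hfin, le_antisymm ?_ ?_, ?_,
      (range_le_of_inverse hP₀.2 hQ₀.2 hPT hRT hTR).2, ?_, hinv, ?_, hinv'⟩
    · rintro _ ⟨x, rfl⟩
      exact ⟨R x, DFunLike.congr_fun hTR x⟩
    · rintro _ ⟨x, rfl⟩
      exact ⟨T x, DFunLike.congr_fun hPT x⟩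
    · rintro _ ⟨x, rfl⟩
      exact ⟨spectralProj (absOp T) δ x, rfl⟩
    · rw [hPT, mul_assoc, hQ₀.2.isIdempotentElem.eq]
    · rw [mul_assoc, hPT', ← mul_assoc, hQ₀.2.isIdempotentElem.eq]
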